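/- Let $\mathbb T\subset\mathbb R$ be a time scale, i.e. a closed set, here unbounded above. Put $\sigma(t)=\inf\{s\in\mathbb T: s>t\}$, $\mu(t)=\sigma(t)-t$, $\mathbb S=\{t\in\mathbb T:\sigma(t)>t\}$, $\mathbb D=\{t\in\mathbb T:\sigma(t)=t\}$, $\mathbb T^+_a=\mathbb T\cap[a,\infty)$, and let $x^\Delta$ denote the $\Delta$-derivative on $\mathbb T$. Let $|\cdot|$ be the Euclidean norm on $\mathbb R^n$ and $B_r=\{x\in\mathbb R^n:|x|<r\}$. Assume that $\mathbb T$ is syndetic: $\limsup_{\mathbb T\ni t\to+\infty}\mu(t)<+\infty$. Let $A$ be a real $n\times n$ matrix that is strongly unstable with respect to $\mathbb T$: its complex eigenvalues, counted with multiplicity, can be split into two groups $\lambda^{(1)}_k$ ($1\le k\le \ell$) and $\lambda^{(2)}_j$ ($1\le j\le n-\ell$) with $1\le\ell\le n$ (the second group may be empty) such that for all $k$, $j$ 1. $\displaystyle\liminf_{\mathbb S\ni t\to+\infty}\frac{|1+\mu(t)\lambda^{(1)}_k|^2-1}{\mu(t)}>0$; 2. $\displaystyle\liminf_{\mathbb S\ni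 t\to+\infty}\frac{|1+\mu(t)\lambda^{(1)}_k|^2-|1+\mu(t)\lambda^{(2)}_j|^2}{\mu(t)}>0$; 3. if $\sup\mathbb D=+\infty$, then moreover $\Re\lambda^{(1)}_k>0$ and $\Re\lambda^{(1)}_k>\Re\lambda^{(2)}_j$. (Lower limits are taken in $[-\infty,+\infty]$, and conditions 1 and 2 are void if $\mathbb S$ is bounded above.) Then there is $\varepsilon>0$ such that for every $r>0$ and every $f:\mathbb T^+_0\times B_r\to\mathbb R^n$ for which there is $r_1\in(0,r]$ with $|f(t,x)|\le\varepsilon|x|$ for all $t\in\mathbb T^+_0$, $x\in B_{r_1}$, the zero solution of $$x^\Delta=Ax+f(t,x)$$ is unstable, in the following sense. (a) It is not stable: there are $t_0\in\mathbb T^+_0$ and $\eta>0$ such that for every $\delta>0$ there is $x_0$ with $|x_0|<\delta$ for which no solution on $\mathbb T^+_{t_0}$ with $x(t_0)=x_0$ satisfies $|x(t)|<\eta$ for all $t\in\mathbb T^+_{t_0}$. (b) If $f$ is continuous on $\mathbb T^+_0\times B_r$, there are $t_0\in\mathbb T^+_0$ and $\eta>0$ such that for every $\delta>0$ there are $t_1\in\mathbb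 T^+_{t_0}$ and a solution $x$ on $\mathbb T\cap[t_0,t_1]$ with $|x(t_0)|<\delta$ and $|x(t_1)|\ge\eta$. Here a solution on $\mathbb T\cap[t_0,t_1]$ or $\mathbb T^+_{t_0}$ is a continuous function on that set which, at each of its points other than the right end point $t_1$, takes a value in $B_r$ and satisfies the equation, the $\Delta$-derivative being taken relative to that set. -/

import Mathlib

open Filter Topology

noncomputable section

namespace TimeScale

/-- Forward jump operator `σ(t) = inf {s ∈ T : s > t}`. -/
def jump (T : Set ℝ) (t : ℝ) : ℝ := sInf {s | s ∈ T ∧ t < s}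

/-- Graininess `μ(t) = σ(t) - t`. -/
def graininess (T : Set ℝ) (t : ℝ) : ℝ := jump T t - t

/-- The set `S` of right-scattered points of `T`. -/
def rightScattered (T : Set ℝ) : Set ℝ := {t | t ∈ T ∧ t < jump T t}

/-- The set `D` of right-dense points of `T`. -/
def rightDense (T : Set ℝ) : Set ℝ := {t | t ∈ T ∧ jump T t = t}

/-- A time scale whose graininess has a finite upper limit as `T ∋ t → +∞`. -/
def IsSyndetic (T : Set ℝ) : Prop :=
  limsup (fun t : ℝ => (graininess T t : EReal)) (atTop ⊓ 𝓟 T) < ⊤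

/-- `A` is strongly unstable with respect to `T`: the complex eigenvalues of `A`, listed with
algebraic multiplicity, split into a nonempty group `Λ₁` and a possibly empty group `Λ₂` subject
to the three conditions below. Lower limits are taken in the extended reals. -/
def IsStronglyUnstable (T : Set ℝ) {n : ℕ} (A : Matrix (Fin n) (Fin n) ℝ) : Prop :=
  ∃ Λ₁ Λ₂ : Multiset ℂ,
    (A.map (algebraMap ℝ ℂ)).charpoly.roots = Λ₁ + Λ₂ ∧ Λ₁ ≠ 0 ∧
    (∀ z ∈ Λ₁, 0 < liminf
      (fun t : ℝ => (((‖1 + (graininess T t : ℂ) * z‖ ^ 2 - 1) / graininess T t : ℝ) : EReal))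
      (atTop ⊓ 𝓟 (rightScattered T))) ∧
    (∀ z ∈ Λ₁, ∀ w ∈ Λ₂, 0 < liminf
      (fun t : ℝ => (((‖1 + (graininess T t : ℂ) * z‖ ^ 2 - ‖1 + (graininess T t : ℂ) * w‖ ^ 2)
        / graininess T t : ℝ) : EReal))
      (atTop ⊓ 𝓟 (rightScattered T))) ∧
    (¬ BddAbove (rightDense T) →
      (∀ z ∈ Λ₁, 0 < z.re) ∧ ∀ z ∈ Λ₁, ∀ w ∈ Λ₂, w.re < z.re)

section Solutions

variable {E : Type*} [NormedAddCommGroup E] [NormedSpace ℝ E]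

/-- `x` has Δ-derivative `x'` at `t`, for a function considered on the part `J` of `T`. -/
def HasDeltaDerivWithinAt (T J : Set ℝ) (x : ℝ → E) (x' : E) (t : ℝ) : Prop :=
  ∀ ε > 0, ∀ᶠ s in 𝓝[J] t,
    ‖(x (jump T t) - x s) - (jump T t - s) • x'‖ ≤ ε * |jump T t - s|

/-- `x` solves `x^Δ = F(t, x)` on `J`, which is `T ∩ [t₀, ∞)` or `T ∩ [t₀, t₁]` in the uses below;
`F(t, ·)` is only looked at on the open ball of radius `r`. The equation is required at every
point of `J` except the last one (if there is a last one), where only continuity is required. -/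
def IsSolutionOn (T : Set ℝ) (r : ℝ) (F : ℝ → E → E) (J : Set ℝ) (x : ℝ → E) : Prop :=
  ContinuousOn x J ∧
  ∀ t ∈ J, (∃ s ∈ J, t < s) →
    x t ∈ Metric.ball (0 : E) r ∧ HasDeltaDerivWithinAt T J x (F t (x t)) t

/-- Stability of the zero solution of `x^Δ = F(t, x)`, `t ∈ T ∩ [0, ∞)`, `‖x‖ < r`: solutions that
start close to zero exist for all later times and remain close to zero. -/
def ZeroIsStable (T : Set ℝ) (r : ℝ) (F : ℝ → E → E) : Prop :=
  ∀ t₀ ∈ T, 0 ≤ t₀ → ∀ η > 0, ∃ δ > 0, ∀ x₀ : E, ‖x₀‖ < δ →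
    ∃ x : ℝ → E, IsSolutionOn T r F (T ∩ Set.Ici t₀) x ∧ x t₀ = x₀ ∧
      ∀ t ∈ T ∩ Set.Ici t₀, ‖x t‖ < η

/-- Actual solutions of `x^Δ = F(t, x)` that start at one and the same time arbitrarily close to
zero reach a fixed distance `η` from zero at some later time. -/
def SolutionsEscapeFromZero (T : Set ℝ) (r : ℝ) (F : ℝ → E → E) : Prop :=
  ∃ t₀ ∈ T, 0 ≤ t₀ ∧ ∃ η > 0, ∀ δ > 0, ∃ x : ℝ → E, ‖x t₀‖ < δ ∧
    ∃ t₁ ∈ T, t₀ ≤ t₁ ∧ IsSolutionOn T r F (T ∩ Set.Icc t₀ t₁) x ∧ η ≤ ‖x t₁‖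

end Solutions

end TimeScale

end

/-! The proof is a Chetaev argument with one quadratic form that serves all late graininesses at
once. Since `(|1 + μλ|² - 1)/μ = 2 Re λ + μ|λ|²`, conditions 1 to 3 say that the weights `q_λ(μ) = 2
Re λ + μ|λ|²` satisfy, at all late times, `q_z ≥ c` and `q_z - q_w ≥ c` for `z` in the first group
and `w` in the second, with a single `c > 0` (`exists_uniform_spectral_gap`); condition 3 covers `μ
= 0`.

Triangularize `A` over `ℂ` with nearly zero off-diagonal part and put `V(y) = Σ ±|y_i|²`, with plus
signs on the first group. For the diagonal part `V^Δ = Σ ± q_i |y_i|²`, which the gap makes at least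
`(c/2)|y|²` where `V ≥ 0`. Off-diagonal terms and the perturbation cost at most half of this because
`μ` is bounded, so `V^Δ ≥ (c/4) V` there. A real vector built from an eigenvector of the first group
makes `V` positive (`exists_chetaev_form`).

Hence `V` grows at least linearly along a solution that starts with `V > 0` and stays in a small
ball (`linear_growth`), while `V` is bounded on that ball: the solution must leave. This already
refutes stability. For actual escaping solutions, Peano's theorem on the time scale is applied to a
truncated equation (`exists_solution_or_exit`). -/

noncomputable section

namespace TimeScale

/-! ### Triangular form with small off-diagonal part -/

open Polynomial in
-- At each `z`, the determinant of `z - f` factors over the invariant line and the quotient by it.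
-- This drives the induction on dimension below.
theorem charpoly_eq_X_sub_C_mul_charpoly_mapQ {V : Type*} [AddCommGroup V] [Module ℂ V]
    [FiniteDimensional ℂ V] (f : V →ₗ[ℂ] V) {a : ℂ} {v : V} (hv : v ≠ 0) (hfv : f v = a • v)
    (hW : (ℂ ∙ v) ≤ (ℂ ∙ v).comap f) :
    f.charpoly = (X - C a) * ((ℂ ∙ v).mapQ (ℂ ∙ v) f hW).charpoly := by
  refine Polynomial.funext fun z => ?_
  have he : (ℂ ∙ v) ≤ (ℂ ∙ v).comap (algebraMap ℂ (Module.End ℂ V) z - f) := by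
    intro x hx
    rw [Submodule.mem_comap, LinearMap.sub_apply, Module.algebraMap_end_apply]
    exact Submodule.sub_mem _ (Submodule.smul_mem _ _ hx) (hW hx)
  rw [LinearMap.eval_charpoly, LinearMap.det_eq_det_mul_det (ℂ ∙ v) _ he, eval_mul,
    LinearMap.eval_charpoly]
  congr 1
  · have : (algebraMap ℂ (Module.End ℂ V) z - f).restrict he
        = (z - a) • (LinearMap.id : (ℂ ∙ v) →ₗ[ℂ] (ℂ ∙ v)) := by
      ext ⟨x, hx⟩
      obtain ⟨b, rfl⟩ := Submodule.mem_span_singleton.1 hx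
      simp [hfv, sub_smul, smul_sub, smul_comm b]
    rw [this, LinearMap.det_smul, finrank_span_singleton hv]
    simp
  · congr 1
    ext x
    simp

/-- Simultaneous triangularization and compression of the off-diagonal part: in suitable
coordinates an endomorphism is upper triangular, with its eigenvalues in any prescribed order on
the diagonal and with arbitrarily small entries off the diagonal. -/
theorem exists_almost_diagonal_coordinates {n : ℕ} {V : Type*} [AddCommGroup V] [Module ℂ V]
    [FiniteDimensional ℂ V] (f : V →ₗ[ℂ] V) (l : Fin n → ℂ)
    (hf : f.charpoly = ∏ i, (Polynomial.X - Polynomial.C (l i))) {ε : ℝ} (hε : 0 < ε) :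
    ∃ (φ : V ≃ₗ[ℂ] (Fin n → ℂ)) (N : Matrix (Fin n) (Fin n) ℂ),
      (∀ i j, j ≤ i → N i j = 0) ∧ (∀ i j, ‖N i j‖ ≤ ε) ∧
      ∀ x i, φ (f x) i = l i * φ x i + ∑ j, N i j * φ x j := by
  have hdim : Module.finrank ℂ V = n := by
    rw [← LinearMap.charpoly_natDegree f, hf, Polynomial.natDegree_finsetProd_X_sub_C_eq_card]
    simp
  induction n generalizing V with
  | zero =>
    refine ⟨LinearEquiv.ofFinrankEq _ _ (by simp [hdim]), 0, fun i => i.elim0, fun i => i.elim0,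
      fun _ i => i.elim0⟩
  | succ n ih =>
    have hroot : f.charpoly.IsRoot (l 0) := by
      simp [hf, Fin.prod_univ_succ]
    obtain ⟨v, hv⟩ := ((Module.End.hasEigenvalue_iff_isRoot_charpoly f _).2 hroot).exists_hasEigenvector
    have hfv : f v = l 0 • v := hv.apply_eq_smul
    have hv0 : v ≠ 0 := hv.2
    have hW : (ℂ ∙ v) ≤ (ℂ ∙ v).comap f := by
      rw [Submodule.span_singleton_le_iff_mem, Submodule.mem_comap, hfv]
      exact Submodule.smul_mem _ _ (Submodule.mem_span_singleton_self v)
    have hq : ((ℂ ∙ v).mapQ (ℂ ∙ v) f hW).charpoly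
        = ∏ i : Fin n, (Polynomial.X - Polynomial.C (l i.succ)) := by
      have h := charpoly_eq_X_sub_C_mul_charpoly_mapQ f hv0 hfv hW
      rw [hf, Fin.prod_univ_succ] at h
      exact (mul_left_cancel₀ (Polynomial.X_sub_C_ne_zero _) h).symm
    have hdq : Module.finrank ℂ (V ⧸ (ℂ ∙ v)) = n := by
      have := Submodule.finrank_quotient_add_finrank (ℂ ∙ v)
      rw [finrank_span_singleton hv0, hdim] at this
      omega
    obtain ⟨ψ, N, hN0, hNε, hN⟩ := ih _ _ hq hdq
    obtain ⟨g, hg⟩ := Module.Projective.exists_dual_eq_one ℂ hv0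
    -- `g` is the new first coordinate. Its defect `g ∘ f - l 0 • g` kills `v`, so it depends only
    -- on the quotient coordinates and supplies the first row of `N`.
    have hker : (ℂ ∙ v) ≤ LinearMap.ker (g ∘ₗ f - l 0 • g) := by
      rw [Submodule.span_singleton_le_iff_mem, LinearMap.mem_ker]
      simp [hfv, hg]
    set h := ((ℂ ∙ v).liftQ _ hker) ∘ₗ ψ.symm.toLinearMap with hh
    have hsum : ∀ x, g (f x) = l 0 * g x
        + ∑ j, h (Pi.single j 1) * ψ (Submodule.Quotient.mk x) j := by
      intro x
      have h1 : h (ψ (Submodule.Quotient.mk x)) = g (f x) - l 0 * g x := by simp [hh]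
      rw [LinearMap.pi_apply_eq_sum_univ h] at h1
      rw [← sub_eq_iff_eq_add', ← h1]
      refine Finset.sum_congr rfl fun j _ => ?_
      rw [smul_eq_mul, mul_comm]
      congr 2
      ext k
      simp [Pi.single_apply, eq_comm]
    -- Scaling the first coordinate by `ε / K` scales the first row by the same factor and leaves
    -- the other rows alone; the summand 1 keeps `K` positive.
    set K : ℝ := 1 + ∑ j, ‖h (Pi.single j 1)‖ with hK
    have hK1 : ∀ j, ‖h (Pi.single j 1)‖ ≤ K := fun j => by
      have := Finset.single_le_sum (f := fun j => ‖h (Pi.single j 1)‖)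
        (fun i _ => norm_nonneg _) (Finset.mem_univ j)
      linarith
    have hK0 : 0 < K := by positivity
    have hη0 : ((ε / K : ℝ) : ℂ) ≠ 0 := by
      exact_mod_cast (div_pos hε hK0).ne'
    let φ₀ : V →ₗ[ℂ] (Fin (n + 1) → ℂ) := LinearMap.pi (Fin.cons (((ε / K : ℝ) : ℂ) • g)
      fun i => LinearMap.proj i ∘ₗ ψ.toLinearMap ∘ₗ (ℂ ∙ v).mkQ)
    have hφ0 : ∀ x, φ₀ x 0 = ((ε / K : ℝ) : ℂ) * g x := fun x => by simp [φ₀]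
    have hφs : ∀ x (i : Fin n), φ₀ x i.succ = ψ (Submodule.Quotient.mk x) i :=
      fun x i => by simp [φ₀]
    have hinj : Function.Injective φ₀ := by
      rw [← LinearMap.ker_eq_bot, LinearMap.ker_eq_bot']
      intro x hx
      have h1 : ψ (Submodule.Quotient.mk x) = 0 := by
        ext i
        rw [← hφs, hx]
        rfl
      rw [LinearEquiv.map_eq_zero_iff, Submodule.Quotient.mk_eq_zero,
        Submodule.mem_span_singleton] at h1
      obtain ⟨a, rfl⟩ := h1
      have h2 := hφ0 (a • v)
      rw [hx, map_smul, hg] at h2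
      have : a = 0 := by simpa [hη0, hε.ne', hK0.ne'] using h2
      rw [this, zero_smul]
    refine ⟨LinearMap.linearEquivOfInjective φ₀ hinj (by simp [hdim]),
      Matrix.of (Fin.cons (Fin.cons 0 fun j => ((ε / K : ℝ) : ℂ) * h (Pi.single j 1))
        fun i => Fin.cons 0 (N i)), ?_, ?_, ?_⟩
    · intro i j hij
      induction i using Fin.cases with
      | zero => simp [Fin.le_zero_iff.1 hij]
      | succ i =>
        induction j using Fin.cases with
        | zero => simp
        | succ j => simpa using hN0 i j (Fin.succ_le_succ_iff.1 hij)
    · intro i j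
      induction i using Fin.cases with
      | zero =>
        induction j using Fin.cases with
        | zero => simpa using hε.le
        | succ j =>
          simp only [Matrix.of_apply, Fin.cons_zero, Fin.cons_succ]
          rw [norm_mul, Complex.norm_real, Real.norm_of_nonneg (by positivity), div_mul_eq_mul_div,
            div_le_iff₀ hK0]
          exact mul_le_mul_of_nonneg_left (hK1 j) hε.le
      | succ i =>
        induction j using Fin.cases with
        | zero => simpa using hε.le
        | succ j => simpa using hNε i j
    · intro x i
      simp only [LinearMap.linearEquivOfInjective_apply]
      induction i using Fin.cases with
      | zero =>
        rw [Fin.sum_univ_succ]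
        simp only [hφ0, hφs, Matrix.of_apply, Fin.cons_zero, Fin.cons_succ, hsum, mul_add,
          Finset.mul_sum, zero_mul, zero_add]
        congr 1
        · ring
        · exact Finset.sum_congr rfl fun j _ => by ring
      | succ i =>
        rw [Fin.sum_univ_succ]
        simp only [hφs, Matrix.of_apply, Fin.cons_zero, Fin.cons_succ, zero_mul, zero_add]
        rw [← hN]
        simp

/-! ### Jump operator, graininess and the uniform spectral gap -/

section

variable {T : Set ℝ}

theorem jump_mem (hT : IsClosed T) (hT_top : ¬ BddAbove T) (t : ℝ) : jump T t ∈ T := by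
  have hne : {s | s ∈ T ∧ t < s}.Nonempty := by
    obtain ⟨s, hs, hts⟩ := not_bddAbove_iff.1 hT_top t
    exact ⟨s, hs, hts⟩
  have hb : BddBelow {s | s ∈ T ∧ t < s} := ⟨t, fun s hs => hs.2.le⟩
  exact hT.closure_subset_iff.2 (fun s hs => hs.1) (csInf_mem_closure hne hb)

theorem le_jump (hT_top : ¬ BddAbove T) (t : ℝ) : t ≤ jump T t := by
  obtain ⟨s, hs, hts⟩ := not_bddAbove_iff.1 hT_top t
  exact le_csInf ⟨s, hs, hts⟩ fun s hs => hs.2.le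

theorem jump_le {s t : ℝ} (hs : s ∈ T) (hts : t < s) : jump T t ≤ s :=
  csInf_le ⟨t, fun _ hs => hs.2.le⟩ ⟨hs, hts⟩

theorem graininess_nonneg (hT_top : ¬ BddAbove T) (t : ℝ) : 0 ≤ graininess T t :=
  sub_nonneg.2 (le_jump hT_top t)

theorem graininess_eq_zero_of_notMem_rightScattered (hT_top : ¬ BddAbove T) {t : ℝ} (ht : t ∈ T)
    (h : t ∉ rightScattered T) : graininess T t = 0 := by
  have h1 : ¬ t < jump T t := fun h' => h ⟨ht, h'⟩
  exact sub_eq_zero.2 (le_antisymm (not_lt.1 h1) (le_jump hT_top t))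

/-- Turns the quotients in the instability conditions into expressions affine in the graininess,
which still make sense at zero graininess. -/
theorem norm_one_add_mul_sq (m : ℝ) (z : ℂ) :
    ‖1 + (m : ℂ) * z‖ ^ 2 = 1 + m * (2 * z.re + m * ‖z‖ ^ 2) := by
  rw [← Complex.normSq_eq_norm_sq, ← Complex.normSq_eq_norm_sq, Complex.normSq_apply,
    Complex.normSq_apply]
  simp
  ring

/-- A positive lower limit along the right-scattered points and positivity of the limiting value at
zero graininess give a positive lower bound at all sufficiently late points of the time scale. -/
theorem eventually_le_of_liminf_pos (hT_top : ¬ BddAbove T) {u q : ℝ → ℝ}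
    (hq : ∀ t ∈ rightScattered T, u t = q (graininess T t))
    (hS : 0 < liminf (fun t => (u t : EReal)) (atTop ⊓ 𝓟 (rightScattered T)))
    (hD : ¬ BddAbove (rightDense T) → 0 < q 0) :
    ∀ᶠ c in 𝓝[>] (0 : ℝ), ∀ᶠ t in atTop ⊓ 𝓟 T, c ≤ q (graininess T t) := by
  obtain ⟨d, hd0, hd⟩ := EReal.lt_iff_exists_real_btwn.1 hS
  have hd0 : 0 < d := by exact_mod_cast hd0
  have hev := eventually_lt_of_lt_liminf hd
  rw [eventually_inf_principal] at hev
  -- If the right-dense points are bounded, every late point is right-scattered; otherwise a late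
  -- point may have graininess zero, where the value is `q 0`.
  by_cases hb : BddAbove (rightDense T)
  · obtain ⟨B, hB⟩ := hb
    filter_upwards [Ioo_mem_nhdsGT hd0] with c hc
    rw [eventually_inf_principal]
    filter_upwards [hev, eventually_gt_atTop B] with t h1 h2 ht
    have hs : t ∈ rightScattered T := by
      refine ⟨ht, lt_of_le_of_ne (le_jump hT_top t) fun h => ?_⟩
      exact absurd (hB ⟨ht, h.symm⟩) (not_le.2 h2)
    rw [← hq t hs]
    exact hc.2.le.trans (by exact_mod_cast (h1 hs).le)
  · filter_upwards [Ioo_mem_nhdsGT (lt_min hd0 (hD hb))] with c hc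
    rw [eventually_inf_principal]
    filter_upwards [hev] with t h1 ht
    by_cases hs : t ∈ rightScattered T
    · rw [← hq t hs]
      exact (hc.2.le.trans (min_le_left _ _)).trans (by exact_mod_cast (h1 hs).le)
    · rw [graininess_eq_zero_of_notMem_rightScattered hT_top ht hs]
      exact hc.2.le.trans (min_le_right _ _)

theorem exists_uniform_spectral_gap (hT_top : ¬ BddAbove T) (hsynd : IsSyndetic T)
    {Λ₁ Λ₂ : Multiset ℂ}
    (h1 : ∀ z ∈ Λ₁, 0 < liminf
      (fun t : ℝ => (((‖1 + (graininess T t : ℂ) * z‖ ^ 2 - 1) / graininess T t : ℝ) : EReal))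
      (atTop ⊓ 𝓟 (rightScattered T)))
    (h2 : ∀ z ∈ Λ₁, ∀ w ∈ Λ₂, 0 < liminf
      (fun t : ℝ => (((‖1 + (graininess T t : ℂ) * z‖ ^ 2 - ‖1 + (graininess T t : ℂ) * w‖ ^ 2)
        / graininess T t : ℝ) : EReal))
      (atTop ⊓ 𝓟 (rightScattered T)))
    (h3 : ¬ BddAbove (rightDense T) →
      (∀ z ∈ Λ₁, 0 < z.re) ∧ ∀ z ∈ Λ₁, ∀ w ∈ Λ₂, w.re < z.re) :
    ∃ c > 0, ∃ M ≥ 0, ∃ t₀ ∈ T, 0 ≤ t₀ ∧ ∀ t ∈ T, t₀ ≤ t → graininess T t ≤ M ∧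
      (∀ z ∈ Λ₁, c ≤ 2 * z.re + graininess T t * ‖z‖ ^ 2) ∧
      ∀ z ∈ Λ₁, ∀ w ∈ Λ₂, c ≤ (2 * z.re + graininess T t * ‖z‖ ^ 2)
        - (2 * w.re + graininess T t * ‖w‖ ^ 2) := by
  have e1 : ∀ z ∈ Λ₁.toFinset, ∀ᶠ c in 𝓝[>] (0 : ℝ), ∀ᶠ t in atTop ⊓ 𝓟 T,
      c ≤ 2 * z.re + graininess T t * ‖z‖ ^ 2 := by
    intro z hz
    rw [Multiset.mem_toFinset] at hz
    refine eventually_le_of_liminf_pos (q := fun m => 2 * z.re + m * ‖z‖ ^ 2) hT_top ?_ (h1 z hz) ?_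
    · intro t ht
      have : graininess T t ≠ 0 := (sub_pos.2 ht.2).ne'
      rw [norm_one_add_mul_sq]
      field_simp
      ring
    · intro hb
      have := (h3 hb).1 z hz
      simpa using this
  have e2 : ∀ z ∈ Λ₁.toFinset, ∀ w ∈ Λ₂.toFinset, ∀ᶠ c in 𝓝[>] (0 : ℝ), ∀ᶠ t in atTop ⊓ 𝓟 T,
      c ≤ (2 * z.re + graininess T t * ‖z‖ ^ 2) - (2 * w.re + graininess T t * ‖w‖ ^ 2) := by
    intro z hz w hw
    rw [Multiset.mem_toFinset] at hz hw
    refine eventually_le_of_liminf_pos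
      (q := fun m => (2 * z.re + m * ‖z‖ ^ 2) - (2 * w.re + m * ‖w‖ ^ 2)) hT_top ?_
      (h2 z hz w hw) ?_
    · intro t ht
      have : graininess T t ≠ 0 := (sub_pos.2 ht.2).ne'
      rw [norm_one_add_mul_sq, norm_one_add_mul_sq]
      field_simp
      ring
    · intro hb
      have := (h3 hb).2 z hz w hw
      simpa using this
  -- Each bound holds for all small `c > 0`, so the finitely many eigenvalues share one `c`.
  have e1' := (eventually_all_finset _).2 e1
  have e2' := (eventually_all_finset _).2 fun z hz => (eventually_all_finset _).2 (e2 z hz)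
  obtain ⟨c, ⟨hc1, hc2⟩, hc0⟩ := ((e1'.and e2').and self_mem_nhdsWithin).exists
  obtain ⟨M, hM, -⟩ := EReal.lt_iff_exists_real_btwn.1 hsynd
  have hM' := eventually_lt_of_limsup_lt hM
  have a1 := (eventually_all_finset _).2 hc1
  have a2 := (eventually_all_finset _).2 fun z hz => (eventually_all_finset _).2 (hc2 z hz)
  have hall := (hM'.and a1).and a2
  rw [eventually_inf_principal, eventually_atTop] at hall
  obtain ⟨τ, hτ⟩ := hall
  obtain ⟨t₀, ht₀, hlt⟩ := not_bddAbove_iff.1 hT_top (max τ 0)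
  refine ⟨c, hc0, max M 0, le_max_right _ _, t₀, ht₀, (le_max_right _ _).trans hlt.le, ?_⟩
  intro t ht htt
  obtain ⟨⟨b0, b1⟩, b2⟩ := hτ t ((le_max_left _ _).trans (hlt.le.trans htt)) ht
  refine ⟨le_max_of_le_left (by exact_mod_cast b0.le), fun z hz => ?_, fun z hz w hw => ?_⟩
  · exact b1 z (Multiset.mem_toFinset.2 hz)
  · exact b2 z (Multiset.mem_toFinset.2 hz) w (Multiset.mem_toFinset.2 hw)

end

/-! ### Diagonal quadratic forms and almost diagonal systems -/

section

/-- The diagonal real quadratic form with coefficients `s` on `ℂⁿ`. -/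
def quadForm {n : ℕ} (s : Fin n → ℝ) (y : Fin n → ℂ) : ℝ := ∑ i, s i * ‖y i‖ ^ 2

/-- The Δ-derivative of `quadForm s` in the direction `g` at a point of graininess `m`. -/
def quadDelta {n : ℕ} (s : Fin n → ℝ) (m : ℝ) (y g : Fin n → ℂ) : ℝ :=
  ∑ i, s i * (2 * inner ℝ (y i) (g i) + m * ‖g i‖ ^ 2)

variable {n : ℕ}

/-- Expansion of a square, exact for every `m`: this is the jump at a right-scattered point, while
`m = 0` in `quadDelta` gives the ordinary derivative. -/
theorem quadForm_add_smul (s : Fin n → ℝ) (m : ℝ) (y g : Fin n → ℂ) :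
    quadForm s (y + m • g) = quadForm s y + m * quadDelta s m y g := by
  simp only [quadForm, quadDelta, Finset.mul_sum, ← Finset.sum_add_distrib]
  refine Finset.sum_congr rfl fun i _ => ?_
  rw [Pi.add_apply, Pi.smul_apply, norm_add_sq_real, inner_smul_right, norm_smul, mul_pow,
    Real.norm_eq_abs, sq_abs]
  ring

theorem quadForm_smul (s : Fin n → ℝ) (a : ℝ) (y : Fin n → ℂ) :
    quadForm s (a • y) = a ^ 2 * quadForm s y := by
  simp only [quadForm, Finset.mul_sum]
  refine Finset.sum_congr rfl fun i _ => ?_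
  rw [Pi.smul_apply, norm_smul, mul_pow, Real.norm_eq_abs, sq_abs]
  ring

theorem continuous_quadForm (s : Fin n → ℝ) : Continuous (quadForm s) := by
  unfold quadForm
  fun_prop

theorem hasDerivWithinAt_quadForm (s : Fin n → ℝ) {Y : ℝ → Fin n → ℂ} {Y' : Fin n → ℂ} {J : Set ℝ}
    {t : ℝ} (h : HasDerivWithinAt Y Y' J t) :
    HasDerivWithinAt (fun t => quadForm s (Y t)) (quadDelta s 0 (Y t) Y') J t := by
  have hi := hasDerivWithinAt_pi.1 h
  refine (HasDerivWithinAt.fun_sum (u := Finset.univ)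
    fun i _ => ((hi i).norm_sq.const_mul (s i))).congr_deriv ?_
  simp [quadDelta]

theorem quadForm_le_sum (s : Fin n → ℝ) (hs : ∀ i, s i = 1 ∨ s i = -1) (y : Fin n → ℂ) :
    quadForm s y ≤ ∑ i, ‖y i‖ ^ 2 := by
  refine Finset.sum_le_sum fun i _ => ?_
  have := sq_nonneg ‖y i‖
  rcases hs i with h | h <;> rw [h] <;> linarith

/-- If the weights `q` on the positive part are at least `c` and exceed those on the negative part
by at least `c`, then the weighted form is positive definite on the cone `quadForm s ≥ 0`. -/
theorem half_mul_sum_le_weighted {s q : Fin n → ℝ} (hs : ∀ i, s i = 1 ∨ s i = -1)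
    (hs1 : ∃ i, s i = 1) {c : ℝ} (hc : 0 ≤ c) (hq : ∀ i, s i = 1 → c ≤ q i)
    (hqq : ∀ i j, s i = 1 → s j = -1 → c ≤ q i - q j) {y : Fin n → ℂ} (hy : 0 ≤ quadForm s y) :
    c / 2 * ∑ i, ‖y i‖ ^ 2 ≤ ∑ i, s i * (q i * ‖y i‖ ^ 2) := by
  classical
  have hne : (Finset.univ.filter fun i => s i = 1).Nonempty := by
    obtain ⟨i, hi⟩ := hs1
    exact ⟨i, by simpa using hi⟩
  -- With `q i₀` the smallest positive-part weight, subtracting `q i₀ - c / 2` times the form leaves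
  -- at least `c / 2` in front of every `‖y i‖ ^ 2`, whatever its sign.
  obtain ⟨i₀, hi₀, hmin⟩ := Finset.exists_min_image _ q hne
  simp only [Finset.mem_filter, Finset.mem_univ, true_and] at hi₀ hmin
  have ha : 0 ≤ (q i₀ - c / 2) * quadForm s y :=
    mul_nonneg (by linarith [hq i₀ hi₀]) hy
  have hsum : c / 2 * ∑ i, ‖y i‖ ^ 2 + (q i₀ - c / 2) * quadForm s y
      ≤ ∑ i, s i * (q i * ‖y i‖ ^ 2) := by
    rw [quadForm, Finset.mul_sum, Finset.mul_sum, ← Finset.sum_add_distrib]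
    refine Finset.sum_le_sum fun i _ => ?_
    have h0 := sq_nonneg ‖y i‖
    rcases hs i with h | h
    · have := mul_le_mul_of_nonneg_right (hmin i h) h0
      rw [h]
      linarith
    · have := mul_le_mul_of_nonneg_right (hqq i₀ i hi₀ h) h0
      rw [h]
      linarith
  linarith

/-- After the diagonal part is removed, every remaining term contains `e`. The bound `ε ≤ 1` absorbs
`ε ^ 2` into `ε`, and `M` makes the estimate uniform in the graininess. -/
theorem abs_delta_norm_sq_sub_le {y e l : ℂ} {m M K ρ ε : ℝ} (hm : 0 ≤ m) (hmM : m ≤ M)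
    (hl : ‖l‖ ≤ K) (hy : ‖y‖ ≤ ρ) (he : ‖e‖ ≤ ε * ρ) (hε : 0 ≤ ε) (hε1 : ε ≤ 1) :
    |(2 * inner ℝ y (l * y + e) + m * ‖l * y + e‖ ^ 2)
      - (2 * l.re + m * ‖l‖ ^ 2) * ‖y‖ ^ 2| ≤ (2 + 2 * M * K + M) * ε * ρ ^ 2 := by
  have hρ : 0 ≤ ρ := (norm_nonneg _).trans hy
  have hK : 0 ≤ K := (norm_nonneg _).trans hl
  have hM : 0 ≤ M := hm.trans hmM
  have hre : inner ℝ y (l * y) = l.re * ‖y‖ ^ 2 := by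
    rw [Complex.inner, ← Complex.normSq_eq_norm_sq, Complex.normSq_apply]
    simp
    ring
  have heq : (2 * inner ℝ y (l * y + e) + m * ‖l * y + e‖ ^ 2)
      - (2 * l.re + m * ‖l‖ ^ 2) * ‖y‖ ^ 2
      = 2 * inner ℝ y e + 2 * m * inner ℝ (l * y) e + m * ‖e‖ ^ 2 := by
    rw [inner_add_right, hre, norm_add_sq_real, norm_mul]
    ring
  rw [heq]
  have h1 : |inner ℝ y e| ≤ ε * ρ ^ 2 := by
    refine (abs_real_inner_le_norm _ _).trans ?_
    calc ‖y‖ * ‖e‖ ≤ ρ * (ε * ρ) := by gcongr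
      _ = _ := by ring
  have h2 : |m * inner ℝ (l * y) e| ≤ M * K * ε * ρ ^ 2 := by
    rw [abs_mul, abs_of_nonneg hm]
    calc m * |inner ℝ (l * y) e| ≤ m * (‖l * y‖ * ‖e‖) := by
          gcongr
          exact abs_real_inner_le_norm _ _
      _ = m * (‖l‖ * ‖y‖ * ‖e‖) := by rw [norm_mul]
      _ ≤ M * (K * ρ * (ε * ρ)) := by gcongr
      _ = _ := by ring
  have h3 : |m * ‖e‖ ^ 2| ≤ M * ε * ρ ^ 2 := by
    rw [abs_of_nonneg (by positivity)]
    calc m * ‖e‖ ^ 2 ≤ M * (ε * ρ) ^ 2 := by gcongr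
      _ = M * ρ ^ 2 * (ε * ε) := by ring
      _ ≤ M * ρ ^ 2 * (ε * 1) := by gcongr
      _ = _ := by ring
  rw [abs_le] at h1 h2 h3 ⊢
  constructor <;> linarith

/-- The quadratic form grows along an almost diagonal system wherever it is nonnegative. -/
theorem le_quadDelta_of_almost_diagonal {s : Fin n → ℝ} (hs : ∀ i, s i = 1 ∨ s i = -1)
    (hs1 : ∃ i, s i = 1) {l : Fin n → ℂ} {c m M K ε : ℝ} (hc : 0 ≤ c) (hm : 0 ≤ m) (hmM : m ≤ M)
    (hl : ∀ i, ‖l i‖ ≤ K) (hε : 0 ≤ ε) (hε1 : ε ≤ 1)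
    (hεc : n * ((2 + 2 * M * K + M) * ε) ≤ c / 4)
    (hq : ∀ i, s i = 1 → c ≤ 2 * (l i).re + m * ‖l i‖ ^ 2)
    (hqq : ∀ i j, s i = 1 → s j = -1 →
      c ≤ (2 * (l i).re + m * ‖l i‖ ^ 2) - (2 * (l j).re + m * ‖l j‖ ^ 2))
    {y e : Fin n → ℂ} (he : ∀ i, ‖e i‖ ≤ ε * √(∑ i, ‖y i‖ ^ 2)) (hy : 0 ≤ quadForm s y) :
    c / 4 * quadForm s y ≤ quadDelta s m y (fun i => l i * y i + e i) := by
  set N := ∑ i, ‖y i‖ ^ 2 with hN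
  have hN0 : 0 ≤ N := Finset.sum_nonneg fun i _ => sq_nonneg _
  have hρ : √N ^ 2 = N := Real.sq_sqrt hN0
  have hyρ : ∀ i, ‖y i‖ ≤ √N := fun i =>
    Real.le_sqrt_of_sq_le (Finset.single_le_sum (f := fun i => ‖y i‖ ^ 2)
      (fun i _ => sq_nonneg _) (Finset.mem_univ i))
  have hmain := half_mul_sum_le_weighted hs hs1 hc hq hqq hy
  have hterm : ∀ i, s i * ((2 * (l i).re + m * ‖l i‖ ^ 2) * ‖y i‖ ^ 2)
      - (2 + 2 * M * K + M) * ε * N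
      ≤ s i * (2 * inner ℝ (y i) (l i * y i + e i) + m * ‖l i * y i + e i‖ ^ 2) := by
    intro i
    have := abs_delta_norm_sq_sub_le hm hmM (hl i) (hyρ i) (he i) hε hε1
    rw [hρ, abs_le] at this
    rcases hs i with h | h <;> rw [h] <;> linarith [this.1, this.2]
  have hsum := Finset.sum_le_sum fun i (_ : i ∈ Finset.univ) => hterm i
  rw [Finset.sum_sub_distrib, Finset.sum_const, Finset.card_univ, Fintype.card_fin,
    nsmul_eq_mul] at hsum
  have hle := quadForm_le_sum s hs y
  have h4 := mul_le_mul_of_nonneg_right hεc hN0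
  have h5 := mul_le_mul_of_nonneg_left hle (show 0 ≤ c / 4 by linarith)
  unfold quadDelta
  rw [← hN] at hmain h5
  linarith

theorem exists_ordering (Λ₁ Λ₂ : Multiset ℂ) (h : Multiset.card (Λ₁ + Λ₂) = n) :
    ∃ l : Fin n → ℂ, (∀ i : Fin n, (i : ℕ) < Multiset.card Λ₁ → l i ∈ Λ₁) ∧
      (∀ i : Fin n, Multiset.card Λ₁ ≤ (i : ℕ) → l i ∈ Λ₂) ∧
      Multiset.map l Finset.univ.val = Λ₁ + Λ₂ := by
  have hlen : (Λ₁.toList ++ Λ₂.toList).length = n := by simpa using h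
  subst hlen
  refine ⟨(Λ₁.toList ++ Λ₂.toList).get, fun i hi => ?_, fun i hi => ?_, ?_⟩
  · rw [List.get_eq_getElem, List.getElem_append_left (by simpa using hi), ← Multiset.mem_toList]
    exact List.getElem_mem _
  · rw [List.get_eq_getElem, List.getElem_append_right (by simpa using hi), ← Multiset.mem_toList]
    exact List.getElem_mem _
  · rw [Fin.univ_val_map, List.ofFn_get, ← Multiset.coe_add, Multiset.coe_toList,
      Multiset.coe_toList]

/-- An eigenvector of an upper triangular map has no components beyond the part of the diagonal
that contains its eigenvalue. -/
theorem eigenvector_coordinates_eq_zero {l : Fin n → ℂ} {N : Matrix (Fin n) (Fin n) ℂ}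
    (hN : ∀ i j, j ≤ i → N i j = 0) {w : ℂ} {k : ℕ} (hw : ∀ i : Fin n, k ≤ (i : ℕ) → l i ≠ w)
    {u : Fin n → ℂ} (hu : ∀ i, l i * u i + ∑ j, N i j * u j = w * u i) (i : Fin n)
    (hi : k ≤ (i : ℕ)) : u i = 0 := by
  induction i using WellFoundedGT.induction with
  | ind i ih =>
    have hsum : ∑ j, N i j * u j = 0 := by
      refine Finset.sum_eq_zero fun j _ => ?_
      rcases le_or_gt j i with h | h
      · rw [hN i j h, zero_mul]
      · rw [ih j h (hi.trans (by exact_mod_cast h.le)), mul_zero]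
    have h := hu i
    rw [hsum, add_zero] at h
    by_contra h0
    exact hw i hi (mul_right_cancel₀ h0 h)

end

/-! ### Complexification and the Chetaev form -/

section

variable {n : ℕ}

/-- The inclusion of `ℝⁿ` in `ℂⁿ`. -/
def complexInclusion (n : ℕ) : EuclideanSpace ℝ (Fin n) →ₗ[ℝ] (Fin n → ℂ) where
  toFun x i := x i
  map_add' x y := by
    ext i
    simp
  map_smul' a x := by
    ext i
    simp

@[simp]
theorem complexInclusion_apply (x : EuclideanSpace ℝ (Fin n)) (i : Fin n) :
    complexInclusion n x i = x i := rfl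

theorem complexInclusion_injective : Function.Injective (complexInclusion n) := by
  intro x y h
  ext i
  exact Complex.ofReal_injective (congrFun h i)

theorem complexInclusion_toEuclideanLin (A : Matrix (Fin n) (Fin n) ℝ)
    (x : EuclideanSpace ℝ (Fin n)) :
    complexInclusion n (Matrix.toEuclideanLin A x)
      = Matrix.toLin' (A.map (algebraMap ℝ ℂ)) (complexInclusion n x) := by
  ext i
  simp [Matrix.toLpLin_apply, Matrix.mulVec, dotProduct]

/-- The real or the imaginary part of `v` is nonzero, and both are combinations of `v` and its
conjugate. -/
theorem exists_real_combination (v : Fin n → ℂ) (hv : v ≠ 0) :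
    ∃ x : EuclideanSpace ℝ (Fin n), x ≠ 0 ∧
      ∃ a b : ℂ, complexInclusion n x = a • v + b • star v := by
  by_cases h : ∀ i, (v i).re = 0
  · refine ⟨WithLp.toLp 2 fun i => (v i).im, fun h0 => hv ?_, -Complex.I / 2, Complex.I / 2, ?_⟩
    · ext i
      have : (v i).im = 0 := by simpa using congrArg (fun x => x.ofLp i) h0
      exact Complex.ext (h i) this
    · ext i
      apply Complex.ext <;> (simp; ring)
  · refine ⟨WithLp.toLp 2 fun i => (v i).re, fun h0 => h fun i => ?_, 1 / 2, 1 / 2, ?_⟩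
    · simpa using congrArg (fun x => x.ofLp i) h0
    · ext i
      apply Complex.ext
      · simp
        ring
      · simp

theorem toLin'_map_star (A : Matrix (Fin n) (Fin n) ℝ) (v : Fin n → ℂ) :
    Matrix.toLin' (A.map (algebraMap ℝ ℂ)) (star v)
      = star (Matrix.toLin' (A.map (algebraMap ℝ ℂ)) v) := by
  ext i
  simp [Matrix.mulVec, dotProduct]

open Polynomial in
theorem charpoly_eq_prod_of_roots {B : Matrix (Fin n) (Fin n) ℂ} {l : Fin n → ℂ}
    (h : B.charpoly.roots = Multiset.map l Finset.univ.val) :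
    (Matrix.toLin' B).charpoly = ∏ i, (X - C (l i)) := by
  rw [Matrix.charpoly_toLin',
    (IsAlgClosed.splits B.charpoly).eq_prod_roots_of_monic B.charpoly_monic, h, Multiset.map_map]
  rfl

theorem quadForm_pos_of_eq_zero {s : Fin n → ℝ} {y : Fin n → ℂ} (hy : y ≠ 0)
    (h : ∀ i, s i = 1 ∨ y i = 0) : 0 < quadForm s y := by
  obtain ⟨i, hi⟩ := Function.ne_iff.1 hy
  have hterm : ∀ i, 0 ≤ s i * ‖y i‖ ^ 2 := fun i => by
    rcases h i with h | h <;> simp [h]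
  refine Finset.sum_pos' (fun i _ => hterm i) ⟨i, Finset.mem_univ i, ?_⟩
  rcases h i with h | h
  · rw [h, one_mul]
    exact pow_pos (norm_pos_iff.2 hi) 2
  · exact absurd h hi

/-- A strict quadratic Chetaev function for `x^Δ = A x + h(x)` with a linearly small perturbation
`h`, valid simultaneously for all graininesses in `G`. -/
theorem exists_chetaev_form (A : Matrix (Fin n) (Fin n) ℝ) {Λ₁ Λ₂ : Multiset ℂ}
    (hroots : (A.map (algebraMap ℝ ℂ)).charpoly.roots = Λ₁ + Λ₂) (hΛ : Λ₁ ≠ 0)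
    {G : Set ℝ} (hG : G.Nonempty) {c M : ℝ} (hc : 0 < c) (hM : 0 ≤ M) (h0 : ∀ m ∈ G, 0 ≤ m ∧ m ≤ M)
    (h1 : ∀ m ∈ G, ∀ z ∈ Λ₁, c ≤ 2 * z.re + m * ‖z‖ ^ 2)
    (h2 : ∀ m ∈ G, ∀ z ∈ Λ₁, ∀ w ∈ Λ₂,
      c ≤ (2 * z.re + m * ‖z‖ ^ 2) - (2 * w.re + m * ‖w‖ ^ 2)) :
    ∃ (L : EuclideanSpace ℝ (Fin n) →L[ℝ] (Fin n → ℂ)) (s : Fin n → ℝ)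
      (x₀ : EuclideanSpace ℝ (Fin n)), 0 < quadForm s (L x₀) ∧ ∃ κ > 0, ∃ ε > 0,
        ∀ m ∈ G, ∀ x h : EuclideanSpace ℝ (Fin n), ‖h‖ ≤ ε * ‖x‖ → 0 ≤ quadForm s (L x) →
          κ * quadForm s (L x) ≤ quadDelta s m (L x) (L (Matrix.toEuclideanLin A x + h)) := by
  set B := A.map (algebraMap ℝ ℂ) with hB
  have hcard : Multiset.card (Λ₁ + Λ₂) = n := by
    rw [← hroots, ← (IsAlgClosed.splits B.charpoly).natDegree_eq_card_roots,
      Matrix.charpoly_natDegree_eq_dim, Fintype.card_fin]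
  obtain ⟨l, hl1, hl2, hl⟩ := exists_ordering Λ₁ Λ₂ hcard
  have hf := charpoly_eq_prod_of_roots (hroots.trans hl.symm)
  set k := Multiset.card Λ₁ with hk
  have hk0 : 0 < k := Multiset.card_pos.2 hΛ
  have hkn : k ≤ n := by
    rw [Multiset.card_add] at hcard
    omega
  set s : Fin n → ℝ := fun i => if (i : ℕ) < k then 1 else -1 with hs
  have hs_pm : ∀ i, s i = 1 ∨ s i = -1 := fun i => by
    by_cases h : (i : ℕ) < k <;> simp [hs, h]
  have hs_one : ∀ i, s i = 1 → (i : ℕ) < k := fun i hi => by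
    by_contra h
    simp only [hs, h, if_false] at hi
    norm_num at hi
  have hs_neg : ∀ i, s i = -1 → k ≤ (i : ℕ) := fun i hi => by
    by_contra h
    simp only [hs, not_le.1 h, if_true] at hi
    norm_num at hi
  set K : ℝ := ∑ i, ‖l i‖ with hK
  have hlK : ∀ i, ‖l i‖ ≤ K := fun i =>
    Finset.single_le_sum (f := fun i => ‖l i‖) (fun i _ => norm_nonneg _) (Finset.mem_univ i)
  have hK0 : 0 ≤ K := Finset.sum_nonneg fun i _ => norm_nonneg _
  obtain ⟨δ, hδ0, hδ1, hδc⟩ : ∃ δ > 0, δ ≤ 1 ∧ n * ((2 + 2 * M * K + M) * δ) ≤ c / 4 := by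
    have hP : 0 < n * (2 + 2 * M * K + M) + 1 := by positivity
    refine ⟨min 1 (c / 4 / (n * (2 + 2 * M * K + M) + 1)), by positivity, min_le_left _ _, ?_⟩
    set δ := min 1 (c / 4 / (n * (2 + 2 * M * K + M) + 1)) with hδ
    have hδ0 : 0 < δ := by positivity
    have : δ * (n * (2 + 2 * M * K + M) + 1) ≤ c / 4 := (le_div_iff₀ hP).1 (min_le_right _ _)
    linarith
  -- The error budget `δ` is halved: a row of `N` has `n` entries and uses at most `δ / 2`, the
  -- perturbation `h` the other half.
  obtain ⟨φ, N, hN0, hNε, hN⟩ := exists_almost_diagonal_coordinates (Matrix.toLin' B) l hf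
    (show 0 < δ / (2 * (n + 1)) by positivity)
  set L₀ : EuclideanSpace ℝ (Fin n) →ₗ[ℝ] (Fin n → ℂ) :=
    (φ.toLinearMap.restrictScalars ℝ) ∘ₗ complexInclusion n with hL₀
  have hL₀_apply : ∀ x, L₀ x = φ (complexInclusion n x) := fun x => rfl
  have hL₀_inj : Function.Injective L₀ := φ.injective.comp complexInclusion_injective
  obtain ⟨C, hC0, hC⟩ := L₀.exists_antilipschitzWith (LinearMap.ker_eq_bot.2 hL₀_inj)
  set L : EuclideanSpace ℝ (Fin n) →L[ℝ] (Fin n → ℂ) := LinearMap.toContinuousLinearMap L₀ with hL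
  have hL_apply : ∀ x, L x = φ (complexInclusion n x) := fun x => rfl
  have hsup : ∀ x, ‖x‖ ≤ C * ‖L x‖ := fun x => by
    have := hC.le_mul_dist x 0
    rwa [map_zero, dist_zero_right, dist_zero_right] at this
  have hLA : ∀ x i, L (Matrix.toEuclideanLin A x) i = l i * L x i + ∑ j, N i j * L x j := by
    intro x i
    rw [hL_apply, hL_apply, complexInclusion_toEuclideanLin, hN]
  obtain ⟨m₀, hm₀⟩ := hG
  obtain ⟨z, hz⟩ := Multiset.exists_mem_of_ne_zero hΛ
  have hz2 : ∀ w ∈ Λ₂, w ≠ z := by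
    rintro w hw rfl
    have := h2 m₀ hm₀ w hz w hw
    linarith
  -- Conjugate numbers have equal weights, so the gap keeps `star z` out of the second group. Hence
  -- both `v` and `star v` have no coordinates there.
  have hz2' : ∀ w ∈ Λ₂, w ≠ star z := by
    rintro w hw rfl
    have := h2 m₀ hm₀ z hz _ hw
    simp only [Complex.star_def, Complex.conj_re, Complex.norm_conj] at this
    linarith
  have hz_root : (Matrix.toLin' B).charpoly.IsRoot z := by
    rw [Matrix.charpoly_toLin']
    refine Polynomial.isRoot_of_mem_roots ?_
    rw [hroots]
    exact Multiset.mem_add.2 (Or.inl hz)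
  obtain ⟨v, hv⟩ := ((Module.End.hasEigenvalue_iff_isRoot_charpoly _ _).2
    hz_root).exists_hasEigenvector
  have hBv : Matrix.toLin' B v = z • v := hv.apply_eq_smul
  have hBv' : Matrix.toLin' B (star v) = star z • star v := by
    rw [toLin'_map_star, ← hB, hBv, star_smul]
  have hzero : ∀ i : Fin n, k ≤ (i : ℕ) → φ v i = 0 := by
    refine eigenvector_coordinates_eq_zero hN0 (w := z) (fun i hi => hz2 _ (hl2 i hi)) fun i => ?_
    rw [← hN, hBv, map_smul, Pi.smul_apply, smul_eq_mul]
  have hzero' : ∀ i : Fin n, k ≤ (i : ℕ) → φ (star v) i = 0 := by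
    refine eigenvector_coordinates_eq_zero hN0 (w := star z)
      (fun i hi => hz2' _ (hl2 i hi)) fun i => ?_
    rw [← hN, hBv', map_smul, Pi.smul_apply, smul_eq_mul]
  obtain ⟨x₀, hx₀, a, b, hab⟩ := exists_real_combination v hv.2
  refine ⟨L, s, x₀, ?_, c / 4, by positivity, δ / (2 * ((‖L‖ + 1) * (C + 1))), by positivity, ?_⟩
  · refine quadForm_pos_of_eq_zero (fun h => hx₀ (hL₀_inj (h.trans (map_zero L₀).symm)))
      fun i => ?_
    by_cases hi : (i : ℕ) < k
    · left
      simp [hs, hi]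
    · right
      rw [hL_apply, hab, map_add, map_smul, map_smul, Pi.add_apply, Pi.smul_apply, Pi.smul_apply,
        hzero i (not_lt.1 hi), hzero' i (not_lt.1 hi), smul_zero, smul_zero, add_zero]
  · intro m hm x h hh hpos
    set e : Fin n → ℂ := fun i => ∑ j, N i j * L x j + L h i with he
    have hsplit : L (Matrix.toEuclideanLin A x + h) = fun i => l i * L x i + e i := by
      ext i
      rw [map_add, Pi.add_apply, hLA, he]
      ring
    rw [hsplit]
    refine le_quadDelta_of_almost_diagonal hs_pm ⟨⟨0, by omega⟩, by simp [hs, hk0]⟩ hc.le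
      (h0 m hm).1 (h0 m hm).2 hlK hδ0.le hδ1 hδc
      (fun i hi => h1 m hm _ (hl1 i (hs_one i hi)))
      (fun i j hi hj => h2 m hm _ (hl1 i (hs_one i hi)) _ (hl2 j (hs_neg j hj)))
      (fun i => ?_) hpos
    set ρ := √(∑ i, ‖L x i‖ ^ 2) with hρ
    have hρ0 : 0 ≤ ρ := Real.sqrt_nonneg _
    have hLρ : ∀ i, ‖L x i‖ ≤ ρ := fun i =>
      Real.le_sqrt_of_sq_le (Finset.single_le_sum (f := fun i => ‖L x i‖ ^ 2)
        (fun i _ => sq_nonneg _) (Finset.mem_univ i))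
    have hxρ : ‖x‖ ≤ (C + 1) * ρ := by
      refine (hsup x).trans ?_
      have : ‖L x‖ ≤ ρ := (pi_norm_le_iff_of_nonneg hρ0).2 hLρ
      have hC1 : (0 : ℝ) ≤ C := C.2
      nlinarith
    have hN' : ‖∑ j, N i j * L x j‖ ≤ δ / 2 * ρ := by
      calc ‖∑ j, N i j * L x j‖ ≤ ∑ _j : Fin n, δ / (2 * (n + 1)) * ρ := by
            refine norm_sum_le_of_le _ fun j _ => ?_
            rw [norm_mul]
            exact mul_le_mul (hNε i j) (hLρ j) (norm_nonneg _) (by positivity)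
        _ = δ / 2 * ρ * (n / (n + 1)) := by
            rw [Finset.sum_const, Finset.card_univ, Fintype.card_fin, nsmul_eq_mul]
            field_simp
        _ ≤ δ / 2 * ρ * 1 := by
            gcongr
            rw [div_le_one (by positivity)]
            linarith
        _ = _ := mul_one _
    have hh' : ‖L h i‖ ≤ δ / 2 * ρ := by
      calc ‖L h i‖ ≤ ‖L h‖ := norm_le_pi_norm _ i
        _ ≤ ‖L‖ * ‖h‖ := L.le_opNorm h
        _ ≤ (‖L‖ + 1) * (δ / (2 * ((‖L‖ + 1) * (C + 1))) * ((C + 1) * ρ)) := by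
            gcongr
            · linarith
            · exact hh.trans (by gcongr)
        _ = _ := by field_simp
    calc ‖e i‖ ≤ ‖∑ j, N i j * L x j‖ + ‖L h i‖ := norm_add_le _ _
      _ ≤ δ * ρ := by linarith

end

/-! ### Δ-derivatives and growth along solutions -/

section

variable {T : Set ℝ} {E : Type*} [NormedAddCommGroup E] [NormedSpace ℝ E]

/-- As `t ∈ J`, the defining estimate may be read at `s = t`, for every `ε`. -/
theorem HasDeltaDerivWithinAt.apply_jump {J : Set ℝ} {x : ℝ → E} {x' : E} {t : ℝ}
    (h : HasDeltaDerivWithinAt T J x x' t) (ht : t ∈ J) :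
    x (jump T t) = x t + graininess T t • x' := by
  have hle : ∀ ε > 0, ‖(x (jump T t) - x t) - graininess T t • x'‖ ≤ ε * |graininess T t| :=
    fun ε hε => (h ε hε).self_of_nhdsWithin ht
  have h0 : ‖(x (jump T t) - x t) - graininess T t • x'‖ ≤ 0 := by
    by_contra hcon
    rw [not_le] at hcon
    have hμ : 0 < |graininess T t| := by
      by_contra h'
      have := hle 1 one_pos
      rw [le_antisymm (not_lt.1 h') (abs_nonneg _)] at this
      linarith
    have := hle (‖(x (jump T t) - x t) - graininess T t • x'‖ / (2 * |graininess T t|))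
      (by positivity)
    rw [div_mul_eq_mul_div, le_div_iff₀ (by positivity)] at this
    nlinarith
  have := norm_le_zero_iff.1 h0
  rw [sub_sub, sub_eq_zero] at this
  exact this

theorem HasDeltaDerivWithinAt.hasDerivWithinAt {J : Set ℝ} {x : ℝ → E} {x' : E} {t : ℝ}
    (h : HasDeltaDerivWithinAt T J x x' t) (ht : jump T t = t) : HasDerivWithinAt x x' J t := by
  rw [hasDerivWithinAt_iff_isLittleO, Asymptotics.isLittleO_iff]
  intro ε hε
  filter_upwards [h ε hε] with s hs
  rw [ht, ← norm_neg] at hs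
  rw [← norm_neg (s - t), neg_sub, Real.norm_eq_abs]
  have heq : x s - x t - (s - t) • x' = -(x t - x s - (t - s) • x') := by module
  rwa [heq]

theorem HasDeltaDerivWithinAt.mono {J J' : Set ℝ} {x : ℝ → E} {x' : E} {t : ℝ}
    (h : HasDeltaDerivWithinAt T J x x' t) (hJ : J' ⊆ J) : HasDeltaDerivWithinAt T J' x x' t :=
  fun ε hε => (h ε hε).filter_mono (nhdsWithin_mono _ hJ)

theorem nhdsWithin_inter_Ioi_neBot (hT_top : ¬ BddAbove T) {t : ℝ} (ht : jump T t = t) :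
    (𝓝[T ∩ Set.Ioi t] t).NeBot := by
  rw [← mem_closure_iff_nhdsWithin_neBot, Metric.mem_closure_iff]
  intro ε hε
  obtain ⟨s₀, hs₀, hts₀⟩ := not_bddAbove_iff.1 hT_top t
  have hlt : sInf {s | s ∈ T ∧ t < s} < t + ε := by
    have : sInf {s | s ∈ T ∧ t < s} = t := ht
    linarith
  obtain ⟨s, ⟨hs, hts⟩, hsε⟩ := exists_lt_of_csInf_lt
    (show {s | s ∈ T ∧ t < s}.Nonempty from ⟨s₀, hs₀, hts₀⟩) hlt
  refine ⟨s, ⟨hs, hts⟩, ?_⟩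
  rw [Real.dist_eq, abs_sub_comm, abs_of_pos (sub_pos.2 hts)]
  linarith

/-- Growth principle on a time scale: if the Δ-derivative of `W` is at least `κ W` wherever
`W ≥ 0`, then `W` grows at least linearly from a positive initial value. -/
theorem linear_growth (hT : IsClosed T) (hT_top : ¬ BddAbove T) {t₀ b : ℝ} (ht₀ : t₀ ∈ T)
    (hb : b ∈ T) (htb : t₀ ≤ b) {W : ℝ → ℝ} (hW : ContinuousOn W (T ∩ Set.Icc t₀ b))
    {κ : ℝ} (hκ : 0 < κ) (hW₀ : 0 < W t₀)
    (hstep : ∀ t ∈ T ∩ Set.Ico t₀ b, 0 ≤ W t → ∃ d, κ * W t ≤ d ∧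
      W (jump T t) = W t + graininess T t * d ∧
      (jump T t = t → HasDerivWithinAt W d (T ∩ Set.Icc t₀ b) t)) :
    W t₀ + κ / 2 * W t₀ * (b - t₀) ≤ W b := by
  set J := T ∩ Set.Icc t₀ b with hJ
  have hJc : IsCompact J := isCompact_Icc.inter_left hT
  set S := J ∩ {t | W t₀ + κ / 2 * W t₀ * (t - t₀) ≤ W t} with hS
  have hSc : IsCompact S := by
    refine hJc.of_isClosed_subset ?_ Set.inter_subset_left
    refine hJc.isClosed.isClosed_le ?_ hW
    fun_prop
  have hSne : S.Nonempty := ⟨t₀, ⟨ht₀, le_rfl, htb⟩, by simp⟩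
  -- At the last time `t` on or above the line, the derivative is at least `κ * W t`. The line has
  -- only half the slope `κ * W t₀`, so if `t < b` a later point also lies on or above it.
  obtain ⟨t, ⟨⟨htT, htI⟩, htW⟩, hmax⟩ := hSc.exists_isGreatest hSne
  simp only [Set.mem_ofPred_eq] at htW
  rcases htI.2.eq_or_lt with rfl | hlt
  · exact htW
  exfalso
  have hWt : W t₀ ≤ W t := by
    have : 0 ≤ κ / 2 * W t₀ * (t - t₀) :=
      mul_nonneg (by positivity) (sub_nonneg.2 htI.1)
    linarith
  obtain ⟨d, hd, hjump, hder⟩ := hstep t ⟨htT, htI.1, hlt⟩ (hW₀.le.trans hWt)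
  have hd' : κ / 2 * W t₀ < d := by nlinarith
  have hnext : ∃ s ∈ T, t < s ∧ s ≤ b ∧ W t + κ / 2 * W t₀ * (s - t) ≤ W s := by
    rcases (le_jump hT_top t).eq_or_lt with heq | hlt'
    · have hslope := hasDerivWithinAt_iff_tendsto_slope.1 (hder heq.symm)
      have hev := hslope.eventually (lt_mem_nhds hd')
      have := nhdsWithin_inter_Ioi_neBot hT_top heq.symm
      have hsub : ∀ᶠ s in 𝓝[T ∩ Set.Ioi t] t, s < b := by
        filter_upwards [mem_nhdsWithin_of_mem_nhds (Iio_mem_nhds hlt)] with s hs using hs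
      have hev2 := eventually_nhdsWithin_iff.1 hev
      obtain ⟨s, ⟨hsT, hts⟩, hsb, hs⟩ := ((eventually_mem_nhdsWithin).and
        (hsub.and (hev2.filter_mono nhdsWithin_le_nhds))).exists
      refine ⟨s, hsT, hts, hsb.le, ?_⟩
      have := hs ⟨⟨hsT, htI.1.trans (le_of_lt hts), hsb.le⟩, ne_of_gt hts⟩
      rw [slope_def_field, lt_div_iff₀ (sub_pos.2 hts)] at this
      linarith
    · refine ⟨jump T t, jump_mem hT hT_top t, hlt', jump_le hb hlt, ?_⟩
      rw [hjump]
      have : κ / 2 * W t₀ * graininess T t ≤ d * graininess T t :=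
        mul_le_mul_of_nonneg_right hd'.le (graininess_nonneg hT_top t)
      unfold graininess at this ⊢
      linarith
  obtain ⟨s, hsT, hts, hsb, hs⟩ := hnext
  refine absurd (hmax ⟨⟨hsT, htI.1.trans hts.le, hsb⟩, ?_⟩) (not_le.2 hts)
  simp only [Set.mem_ofPred_eq]
  linarith

variable {n : ℕ}

/-- Along solutions, a Chetaev form grows at least linearly. -/
theorem quadForm_growth_of_solution (hT : IsClosed T) (hT_top : ¬ BddAbove T)
    {L : E →L[ℝ] (Fin n → ℂ)} {s : Fin n → ℝ} {F : ℝ → E → E} {r η κ t₀ b : ℝ}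
    (ht₀ : t₀ ∈ T) (hb : b ∈ T) (htb : t₀ ≤ b) (hκ : 0 < κ)
    (hF : ∀ t ∈ T, t₀ ≤ t → ∀ x : E, ‖x‖ < η → 0 ≤ quadForm s (L x) →
      κ * quadForm s (L x) ≤ quadDelta s (graininess T t) (L x) (L (F t x)))
    {x : ℝ → E} (hx : IsSolutionOn T r F (T ∩ Set.Icc t₀ b) x)
    (hxη : ∀ t ∈ T ∩ Set.Icc t₀ b, ‖x t‖ < η) (hx₀ : 0 < quadForm s (L (x t₀))) :
    quadForm s (L (x t₀)) + κ / 2 * quadForm s (L (x t₀)) * (b - t₀) ≤ quadForm s (L (x b)) := by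
  refine linear_growth (W := fun t => quadForm s (L (x t))) hT hT_top ht₀ hb htb ?_ hκ hx₀ ?_
  · exact (continuous_quadForm s).comp_continuousOn (L.continuous.comp_continuousOn hx.1)
  · rintro t ⟨htT, ht⟩ hpos
    have htJ : t ∈ T ∩ Set.Icc t₀ b := ⟨htT, ht.1, ht.2.le⟩
    have hder := (hx.2 t htJ ⟨b, ⟨hb, htb, le_rfl⟩, ht.2⟩).2
    refine ⟨_, hF t htT ht.1 _ (hxη t htJ) hpos, ?_, fun hd => ?_⟩
    · rw [hder.apply_jump htJ, map_add, map_smul, quadForm_add_smul]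
    · have hμ : graininess T t = 0 := sub_eq_zero.2 hd
      rw [hμ]
      exact hasDerivWithinAt_quadForm s (L.hasFDerivAt.comp_hasDerivWithinAt t
        (hder.hasDerivWithinAt hd))

end

/-! ### Peano's existence theorem on a time scale -/

section Peano

variable {E : Type*} [NormedAddCommGroup E]

/-- Arzelà–Ascoli on `[t₀, b]`: the common Lipschitz constant gives equicontinuity and, with the
common initial value, a compact range. -/
theorem exists_pointwise_convergent_subsequence [ProperSpace E] {C : NNReal} {t₀ b : ℝ}
    (htb : t₀ ≤ b) {x₀ : E} {X : ℕ → ℝ → E} (hX : ∀ k, LipschitzWith C (X k))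
    (hX₀ : ∀ k, X k t₀ = x₀) :
    ∃ Y : ℝ → E, Continuous Y ∧ ∃ φ : ℕ → ℕ, StrictMono φ ∧
      ∀ t ∈ Set.Icc t₀ b, Tendsto (fun k => X (φ k) t) atTop (𝓝 (Y t)) := by
  let Z : ℕ → BoundedContinuousFunction (Set.Icc t₀ b) E := fun k =>
    BoundedContinuousFunction.mkOfCompact ⟨fun t => X k t, (hX k).continuous.comp
      continuous_subtype_val⟩
  have hcomp : IsCompact (closure (Set.range Z)) := by
    refine BoundedContinuousFunction.arzela_ascoli (Metric.closedBall x₀ (C * (b - t₀)))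
      (isCompact_closedBall _ _) _ ?_ ?_
    · rintro _ ⟨t, ht⟩ ⟨k, rfl⟩
      rw [Metric.mem_closedBall, ← hX₀ k]
      refine ((hX k).dist_le_mul t t₀).trans ?_
      rw [Real.dist_eq, abs_of_nonneg (sub_nonneg.2 ht.1)]
      gcongr
      exact ht.2
    · refine (LipschitzWith.uniformEquicontinuous _ C ?_).equicontinuous
      rintro ⟨_, k, rfl⟩
      have := (hX k).comp (LipschitzWith.subtype_val (Set.Icc t₀ b))
      rw [mul_one] at this
      exact this
  obtain ⟨Y, -, φ, hφ, hlim⟩ := hcomp.tendsto_subseq (x := Z)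
    fun k => subset_closure (Set.mem_range_self k)
  refine ⟨Set.IccExtend htb Y, Y.continuous.Icc_extend', φ, hφ, fun t ht => ?_⟩
  rw [Set.IccExtend_of_mem htb _ ht]
  exact (BoundedContinuousFunction.tendsto_iff_tendstoUniformly.1 hlim).tendsto_at ⟨t, ht⟩

variable [NormedSpace ℝ E] [FiniteDimensional ℝ E] [MeasurableSpace E] [BorelSpace E]

open MeasureTheory in
theorem intervalIntegrable_of_measurable_of_bounded {g : ℝ → E} (hg : Measurable g) {C : ℝ}
    (hC : ∀ s, ‖g s‖ ≤ C) (a b : ℝ) : IntervalIntegrable g volume a b :=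
  (intervalIntegrable_const (c := C)).mono_fun' hg.aestronglyMeasurable
    (Eventually.of_forall hC)

theorem lipschitzWith_add_integral {g : ℝ → E} (hg : Measurable g) {C : NNReal}
    (hC : ∀ s, ‖g s‖ ≤ C) (x₀ : E) (t₀ : ℝ) :
    LipschitzWith C fun t => x₀ + ∫ s in t₀..t, g s := by
  refine LipschitzWith.of_dist_le_mul fun t u => ?_
  have hi := intervalIntegrable_of_measurable_of_bounded hg hC
  rw [dist_eq_norm, add_sub_add_left_eq_sub,
    intervalIntegral.integral_interval_sub_left (hi _ _) (hi _ _), Real.dist_eq]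
  exact intervalIntegral.norm_integral_le_of_norm_le_const fun s _ => hC s

/-- Tonelli's delayed equation: it is solved by finitely many iterations. -/
theorem exists_delayed_solution {G : ℝ → E → E} (hGm : Measurable (Function.uncurry G))
    {C : NNReal} (hG : ∀ s x, ‖G s x‖ ≤ C) {γ : ℝ → ℝ} (hγ : Measurable γ) {t₀ b : ℝ}
    (hγt : ∀ s, t₀ ≤ s → γ s ≤ s) (x₀ : E) {h : ℝ} (hh : 0 < h) :
    ∃ X : ℝ → E, LipschitzWith C X ∧ X t₀ = x₀ ∧
      ∀ t ∈ Set.Icc t₀ b, X t = x₀ + ∫ s in t₀..t, G s (X (max (γ s - h) t₀)) := by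
  let Φ : (ℝ → E) → ℝ → E := fun X t => x₀ + ∫ s in t₀..t, G s (X (max (γ s - h) t₀))
  have hlip : ∀ k, LipschitzWith C (Φ^[k] fun _ => x₀) := by
    intro k
    induction k with
    | zero => exact (LipschitzWith.const x₀).weaken zero_le
    | succ k ih =>
      rw [Function.iterate_succ_apply']
      refine lipschitzWith_add_integral (hGm.comp (measurable_id.prodMk
        (ih.continuous.measurable.comp ((hγ.sub_const h).max measurable_const)))) ?_ x₀ t₀
      exact fun s => hG s _
  have hinit : ∀ k, (Φ^[k] fun _ => x₀) t₀ = x₀ := by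
    intro k
    cases k with
    | zero => rfl
    | succ k =>
      rw [Function.iterate_succ_apply']
      simp [Φ]
  have hagree : ∀ k : ℕ, ∀ t ∈ Set.Icc t₀ (t₀ + k * h),
      (Φ^[k] fun _ => x₀) t = Φ (Φ^[k] fun _ => x₀) t := by
    intro k
    induction k with
    | zero =>
      intro t ht
      have : t = t₀ := le_antisymm (by simpa using ht.2) ht.1
      subst this
      simp [Φ]
    | succ k ih =>
      intro t ht
      rw [Function.iterate_succ_apply']
      refine congrArg (x₀ + ·) (intervalIntegral.integral_congr fun s hs => ?_)
      rw [Set.uIcc_of_le ht.1] at hs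
      -- The delay moves the argument back by `h`, into the interval where the previous iterates
      -- already agree.
      refine congrArg (G s) (ih _ ⟨le_max_right _ _, max_le ?_ ?_⟩)
      · have h1 := hγt s hs.1
        have h2 := hs.2.trans ht.2
        push_cast at h2
        linarith
      · have : 0 ≤ (k : ℝ) * h := by positivity
        linarith
  obtain ⟨N, hN⟩ := exists_nat_ge ((b - t₀) / h)
  rw [div_le_iff₀ hh] at hN
  exact ⟨_, hlip N, hinit N, fun t ht => hagree N t ⟨ht.1, by linarith [ht.2]⟩⟩

/-- Peano's theorem for integral equations with a retarded argument. -/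
theorem exists_integral_solution {G : ℝ → E → E} (hGm : Measurable (Function.uncurry G))
    (hGc : ∀ s, Continuous (G s)) {C : NNReal} (hG : ∀ s x, ‖G s x‖ ≤ C) {γ : ℝ → ℝ}
    (hγ : Measurable γ) {t₀ b : ℝ} (htb : t₀ ≤ b)
    (hγt : ∀ s, t₀ ≤ s → γ s ≤ s) (hγ₀ : ∀ s, t₀ ≤ γ s) (x₀ : E) :
    ∃ X : ℝ → E, Continuous X ∧
      ∀ t ∈ Set.Icc t₀ b, X t = x₀ + ∫ s in t₀..t, G s (X (γ s)) := by
  choose X hXlip hX₀ hX using fun k : ℕ =>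
    exists_delayed_solution hGm hG hγ (b := b) hγt x₀ (Nat.one_div_pos_of_nat (α := ℝ) (n := k))
  obtain ⟨Y, hY, φ, hφ, hlim⟩ := exists_pointwise_convergent_subsequence htb hXlip hX₀
  refine ⟨Y, hY, fun t ht => tendsto_nhds_unique (hlim t ht) ?_⟩
  simp_rw [fun k => hX (φ k) t ht]
  refine tendsto_const_nhds.add ?_
  refine intervalIntegral.tendsto_integral_filter_of_dominated_convergence (fun _ => (C : ℝ))
    (Eventually.of_forall fun k => ?_) (Eventually.of_forall fun k => ?_)
    intervalIntegrable_const (Eventually.of_forall fun s hs => ?_)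
  · exact (hGm.comp (measurable_id.prodMk ((hXlip _).continuous.measurable.comp
      ((hγ.sub_const _).max measurable_const)))).aestronglyMeasurable
  · exact Eventually.of_forall fun s _ => hG s _
  · rw [Set.uIoc_of_le ht.1] at hs
    refine ((hGc s).tendsto _).comp ?_
    have hγs : γ s ∈ Set.Icc t₀ b := ⟨hγ₀ s, (hγt s hs.1.le).trans (hs.2.trans ht.2)⟩
    have hsmall : Tendsto (fun k => (C : ℝ) * (1 / ((φ k : ℝ) + 1))) atTop (𝓝 0) := by
      have := (tendsto_one_div_add_atTop_nhds_zero_nat (𝕜 := ℝ)).comp hφ.tendsto_atTop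
      simpa using this.const_mul (C : ℝ)
    -- The common Lipschitz constant makes the vanishing delay harmless in the limit.
    refine (hlim _ hγs).congr_dist (squeeze_zero (fun _ => dist_nonneg) (fun k => ?_) hsmall)
    refine ((hXlip (φ k)).dist_le_mul _ _).trans ?_
    gcongr
    have hpos : 0 ≤ 1 / ((φ k : ℝ) + 1) := by positivity
    rw [Real.dist_eq, abs_of_nonneg (sub_nonneg.2 (max_le (by linarith) (hγ₀ s)))]
    linarith [le_max_left (γ s - 1 / ((φ k : ℝ) + 1)) t₀]

/-- Peano's theorem on a time scale, for a bounded right-hand side. -/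
theorem exists_solution_of_bounded {T : Set ℝ} (hT : IsClosed T) (hT_top : ¬ BddAbove T)
    {t₀ b : ℝ} (ht₀ : t₀ ∈ T) (hb : b ∈ T) (htb : t₀ ≤ b) {F : ℝ → E → E}
    (hF : ContinuousOn (Function.uncurry F) ((T ∩ Set.Icc t₀ b) ×ˢ Set.univ)) {C : NNReal}
    (hFC : ∀ t ∈ T ∩ Set.Icc t₀ b, ∀ x, ‖F t x‖ ≤ C) (x₀ : E) :
    ∃ X : ℝ → E, Continuous X ∧ X t₀ = x₀ ∧
      ∀ t ∈ T ∩ Set.Icc t₀ b, t < b →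
        HasDeltaDerivWithinAt T (T ∩ Set.Icc t₀ b) X (F t (X t)) t := by
  set J := T ∩ Set.Icc t₀ b with hJ
  -- `γ s` is the last point of `T` up to `s`; the Δ-equation becomes the integral equation with
  -- integrand `F (γ s) (X (γ s))`. Clamping keeps `γ` in `J` and monotone on all of `ℝ`, hence
  -- measurable.
  let cl : ℝ → ℝ := fun s => max t₀ (min s b)
  let γ : ℝ → ℝ := fun s => sSup (T ∩ Set.Icc t₀ (cl s))
  have hclb : ∀ s, cl s ≤ b := fun s => max_le htb (min_le_right _ _)
  have hcl0 : ∀ s, t₀ ≤ cl s := fun s => le_max_left _ _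
  have hcl : ∀ s ∈ Set.Icc t₀ b, cl s = s := fun s hs => by simp [cl, hs.1, hs.2]
  have hne : ∀ s, (T ∩ Set.Icc t₀ (cl s)).Nonempty := fun s => ⟨t₀, ht₀, le_rfl, hcl0 s⟩
  have hbd : ∀ s, BddAbove (T ∩ Set.Icc t₀ (cl s)) := fun s =>
    (bddAbove_Icc).mono Set.inter_subset_right
  have hmem : ∀ s, γ s ∈ T ∩ Set.Icc t₀ (cl s) := fun s =>
    (isCompact_Icc.inter_left hT).sSup_mem (hne s)
  have hmemJ : ∀ s, γ s ∈ J := fun s => ⟨(hmem s).1, (hmem s).2.1, (hmem s).2.2.trans (hclb s)⟩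
  have hmono : Monotone γ := fun s u hsu => csSup_le_csSup (hbd u) (hne s)
    (Set.inter_subset_inter_right T (Set.Icc_subset_Icc_right
      (max_le_max_left _ (min_le_min_right _ hsu))))
  have hγJ : ∀ s ∈ J, γ s = s := fun s hs => by
    refine le_antisymm ?_ (le_csSup (hbd s) ⟨hs.1, hs.2.1, (hcl s hs.2).ge⟩)
    exact (hmem s).2.2.trans (hcl s hs.2).le
  have hγle : ∀ s, t₀ ≤ s → γ s ≤ s := fun s hs =>
    (hmem s).2.2.trans (max_le hs (min_le_left _ _))
  have hFJ : Continuous fun p : J × E => F p.1 p.2 := by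
    have h := hF.comp_continuous (f := fun p : J × E => ((p.1 : ℝ), p.2)) (by fun_prop)
      fun p => ⟨p.1.2, Set.mem_univ _⟩
    exact h
  have hGm : Measurable (Function.uncurry fun s => F (γ s)) := by
    have h1 : Measurable fun p : ℝ × E => ((⟨γ p.1, hmemJ p.1⟩ : J), p.2) :=
      ((hmono.measurable.comp measurable_fst).subtype_mk).prodMk measurable_snd
    exact hFJ.measurable.comp h1
  have hGc : ∀ s, Continuous (F (γ s)) := fun s =>
    hFJ.comp (Continuous.prodMk_right (⟨γ s, hmemJ s⟩ : J))
  obtain ⟨X, hXc, hX⟩ := exists_integral_solution hGm hGc (fun s x => hFC _ (hmemJ s) x)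
    hmono.measurable htb hγle (fun s => (hmem s).2.1) x₀
  have hint : ∀ a c, IntervalIntegrable (fun s => F (γ s) (X (γ s))) MeasureTheory.volume a c :=
    intervalIntegrable_of_measurable_of_bounded (hGm.comp (measurable_id.prodMk
      (hXc.measurable.comp hmono.measurable))) fun s => hFC _ (hmemJ s) _
  have hdiff : ∀ s ∈ Set.Icc t₀ b, ∀ t ∈ Set.Icc t₀ b, ∀ y : E,
      X t - X s - (t - s) • y = ∫ u in s..t, (F (γ u) (X (γ u)) - y) := by
    intro s hs t ht y
    rw [intervalIntegral.integral_sub (hint _ _) intervalIntegrable_const,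
      intervalIntegral.integral_const, hX t ht, hX s hs, add_sub_add_left_eq_sub,
      intervalIntegral.integral_interval_sub_left (hint _ _) (hint _ _)]
  refine ⟨X, hXc, by simpa using hX t₀ ⟨le_rfl, htb⟩, fun t ht htb' ε hε => ?_⟩
  -- Across a gap of `T` the function `γ` stays equal to `t`, so the integrand is constant.
  have hjump : X (jump T t) - X t - (jump T t - t) • F t (X t) = 0 := by
    rcases (le_jump hT_top t).eq_or_lt with heq | hlt
    · simp [← heq]
    · rw [hdiff t ht.2 _ ⟨ht.2.1.trans hlt.le, jump_le hb htb'⟩,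
        ← intervalIntegral.integral_zero (a := t) (b := jump T t) (μ := MeasureTheory.volume),
        intervalIntegral.integral_of_le hlt.le, intervalIntegral.integral_of_le hlt.le,
        MeasureTheory.integral_Ioc_eq_integral_Ioo, MeasureTheory.integral_Ioc_eq_integral_Ioo]
      refine MeasureTheory.setIntegral_congr_fun measurableSet_Ioo fun u hu => ?_
      have h1 : t ≤ γ u := by
        rw [← hγJ t ht]
        exact hmono hu.1.le
      have h2 : γ u = t := by
        refine le_antisymm (not_lt.1 fun h => ?_) h1
        exact absurd ((jump_le (hmem u).1 h).trans (hγle u (ht.2.1.trans hu.1.le)))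
          (not_le.2 hu.2)
      simp [h2]
  have hcont : ContinuousWithinAt (fun v => F v (X v)) J t := by
    have h : ContinuousOn (fun v => F v (X v)) J :=
      hF.comp (continuousOn_id.prodMk hXc.continuousOn) fun v hv => ⟨hv, Set.mem_univ _⟩
    exact h t ht
  obtain ⟨δ, hδ, hδε⟩ := Metric.continuousWithinAt_iff.1 hcont ε hε
  have hnear : ∀ᶠ s in 𝓝[J] t, t < jump T t → s < jump T t := by
    by_cases h : t < jump T t
    · filter_upwards [mem_nhdsWithin_of_mem_nhds (Iio_mem_nhds h)] with s hs _ using hs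
    · exact Eventually.of_forall fun s h' => absurd h' h
  filter_upwards [self_mem_nhdsWithin, hnear,
    mem_nhdsWithin_of_mem_nhds (Metric.ball_mem_nhds t hδ)] with s hs hsj hsδ
  have hsum : X (jump T t) - X s - (jump T t - s) • F t (X t)
      = X t - X s - (t - s) • F t (X t) := by
    rw [← sub_eq_zero, ← hjump]
    module
  -- Near a right-scattered `t`, points of `J` lie at or to the left of `t`.
  have habs : |t - s| ≤ |jump T t - s| := by
    rcases (le_jump hT_top t).eq_or_lt with heq | hlt
    · rw [← heq]
    · have hst : s ≤ t := not_lt.1 fun h => absurd (jump_le hs.1 h) (not_le.2 (hsj hlt))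
      rw [abs_of_nonneg (by linarith), abs_of_nonneg (by linarith)]
      linarith
  rw [hsum, hdiff s hs.2 t ht.2]
  refine le_trans ?_ (mul_le_mul_of_nonneg_left habs hε.le)
  refine intervalIntegral.norm_integral_le_of_norm_le_const fun u hu => ?_
  have hγu : γ u ∈ Set.uIcc s t := by
    refine (Set.mem_uIcc.1 (Set.uIoc_subset_uIcc hu)).elim (fun h => Set.mem_uIcc.2 (Or.inl ?_))
      fun h => Set.mem_uIcc.2 (Or.inr ?_)
    · exact ⟨(hγJ s hs).ge.trans (hmono h.1), (hmono h.2).trans (hγJ t ht).le⟩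
    · exact ⟨(hγJ t ht).ge.trans (hmono h.1), (hmono h.2).trans (hγJ s hs).le⟩
  have hdist : dist (γ u) t < δ := by
    refine lt_of_le_of_lt ?_ (Metric.mem_ball.1 hsδ)
    rw [Real.dist_eq, Real.dist_eq, abs_sub_comm, abs_sub_comm s]
    exact Set.abs_sub_right_of_mem_uIcc hγu
  have := hδε (hmemJ u) hdist
  rw [dist_eq_norm] at this
  exact this.le

end Peano

/-! ### Continuation up to the exit from a ball -/

section Instability

variable {T : Set ℝ} {E : Type*} [NormedAddCommGroup E] [NormedSpace ℝ E]

theorem IsSolutionOn.mono {r : ℝ} {F : ℝ → E → E} {J J' : Set ℝ} {x : ℝ → E}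
    (h : IsSolutionOn T r F J x) (hJ : J' ⊆ J) : IsSolutionOn T r F J' x :=
  ⟨h.1.mono hJ, fun t ht ⟨s, hs, hts⟩ =>
    ⟨(h.2 t (hJ ht) ⟨s, hJ hs, hts⟩).1, (h.2 t (hJ ht) ⟨s, hJ hs, hts⟩).2.mono hJ⟩⟩

/-- Radial retraction onto the closed ball of radius `η`. -/
def ballRetraction (η : ℝ) (x : E) : E := (η / max η ‖x‖) • x

theorem continuous_ballRetraction {η : ℝ} (hη : 0 < η) :
    Continuous (ballRetraction η : E → E) := by
  unfold ballRetraction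
  exact (continuous_const.div (by fun_prop) fun x => (lt_max_of_lt_left hη).ne').smul continuous_id

theorem norm_ballRetraction_le {η : ℝ} (hη : 0 < η) (x : E) : ‖ballRetraction η x‖ ≤ η := by
  have hm : 0 < max η ‖x‖ := lt_max_of_lt_left hη
  rw [ballRetraction, norm_smul, Real.norm_of_nonneg (by positivity), div_mul_eq_mul_div,
    div_le_iff₀ hm]
  exact mul_le_mul_of_nonneg_left (le_max_right _ _) hη.le

theorem ballRetraction_of_norm_le {η : ℝ} (hη : 0 < η) {x : E} (hx : ‖x‖ ≤ η) :
    ballRetraction η x = x := by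
  rw [ballRetraction, max_eq_left hx, div_self hη.ne', one_smul]

/-- Local existence and continuation: a solution exists up to time `b`, or up to the first time at
which it leaves the ball of radius `η`. -/
theorem exists_solution_or_exit [FiniteDimensional ℝ E] [MeasurableSpace E] [BorelSpace E]
    (hT : IsClosed T) (hT_top : ¬ BddAbove T) {t₀ b : ℝ} (ht₀ : t₀ ∈ T) (hb : b ∈ T)
    (htb : t₀ ≤ b) {F : ℝ → E → E} {r η : ℝ} (hη : 0 < η) (hηr : η < r)
    (hF : ContinuousOn (Function.uncurry F) ((T ∩ Set.Icc t₀ b) ×ˢ Metric.ball 0 r)) (x₀ : E) :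
    ∃ x : ℝ → E, x t₀ = x₀ ∧
      ((IsSolutionOn T r F (T ∩ Set.Icc t₀ b) x ∧ ∀ t ∈ T ∩ Set.Icc t₀ b, ‖x t‖ < η) ∨
        ∃ t₁ ∈ T, t₀ ≤ t₁ ∧ IsSolutionOn T r F (T ∩ Set.Icc t₀ t₁) x ∧ η ≤ ‖x t₁‖) := by
  have hJc : IsCompact (T ∩ Set.Icc t₀ b) := isCompact_Icc.inter_left hT
  have hρ : ∀ x : E, ballRetraction η x ∈ Metric.closedBall (0 : E) η := fun x =>
    mem_closedBall_zero_iff.2 (norm_ballRetraction_le hη x)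
  have hsub : Metric.closedBall (0 : E) η ⊆ Metric.ball 0 r := Metric.closedBall_subset_ball hηr
  obtain ⟨C, hC⟩ := (hJc.prod (isCompact_closedBall (0 : E) η)).exists_bound_of_continuousOn
    (hF.mono (Set.prod_mono_right hsub))
  have hF' : ContinuousOn (Function.uncurry fun t x => F t (ballRetraction η x))
      ((T ∩ Set.Icc t₀ b) ×ˢ Set.univ) :=
    hF.comp (f := fun p : ℝ × E => (p.1, ballRetraction η p.2))
      (continuous_fst.prodMk ((continuous_ballRetraction hη).comp continuous_snd)).continuousOn
      fun p hp => ⟨hp.1, hsub (hρ p.2)⟩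
  obtain ⟨X, hXc, hX₀, hX⟩ := exists_solution_of_bounded hT hT_top ht₀ hb htb hF'
    (C := C.toNNReal) (fun t ht x => (hC (t, ballRetraction η x) ⟨ht, hρ x⟩).trans
      (Real.le_coe_toNNReal C)) x₀
  have hsol : ∀ t ∈ T ∩ Set.Icc t₀ b, t < b → ‖X t‖ < η →
      X t ∈ Metric.ball (0 : E) r ∧
        HasDeltaDerivWithinAt T (T ∩ Set.Icc t₀ b) X (F t (X t)) t := by
    intro t ht htb' hlt
    refine ⟨mem_ball_zero_iff.2 (hlt.trans hηr), ?_⟩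
    have := hX t ht htb'
    rwa [ballRetraction_of_norm_le hη hlt.le] at this
  refine ⟨X, hX₀, ?_⟩
  by_cases hall : ∀ t ∈ T ∩ Set.Icc t₀ b, ‖X t‖ < η
  · exact Or.inl ⟨⟨hXc.continuousOn, fun t ht ⟨s, hs, hts⟩ =>
      hsol t ht (hts.trans_le hs.2.2) (hall t ht)⟩, hall⟩
  · right
    push Not at hall
    obtain ⟨t, ht, htη⟩ := hall
    have hSc : IsCompact ((T ∩ Set.Icc t₀ b) ∩ {t | η ≤ ‖X t‖}) :=
      hJc.inter_right (isClosed_le continuous_const hXc.norm)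
    -- Before the first exit time the retraction acts as the identity, so the truncated solution
    -- solves the original equation; at `t₁` no equation is required.
    obtain ⟨t₁, ⟨ht₁, ht₁η⟩, hmin⟩ := hSc.exists_isLeast ⟨t, ht, htη⟩
    have hJ' : T ∩ Set.Icc t₀ t₁ ⊆ T ∩ Set.Icc t₀ b :=
      Set.inter_subset_inter_right T (Set.Icc_subset_Icc_right ht₁.2.2)
    refine ⟨t₁, ht₁.1, ht₁.2.1, ⟨hXc.continuousOn, fun t ht ⟨s, hs, hts⟩ => ?_⟩, ht₁η⟩
    have htt₁ : t < t₁ := hts.trans_le hs.2.2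
    have h := hsol t (hJ' ht) (htt₁.trans_le ht₁.2.2)
      (not_le.1 fun h => absurd (hmin ⟨hJ' ht, h⟩) (not_le.2 htt₁))
    exact ⟨h.1, h.2.mono hJ'⟩

variable {n : ℕ} {L : E →L[ℝ] (Fin n → ℂ)} {s : Fin n → ℝ}

theorem exists_small_quadForm_pos {x₀ : E} (hx₀ : 0 < quadForm s (L x₀)) {δ : ℝ} (hδ : 0 < δ) :
    ∃ x : E, ‖x‖ < δ ∧ 0 < quadForm s (L x) := by
  have ha : 0 < δ / (2 * (‖x₀‖ + 1)) := by positivity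
  refine ⟨(δ / (2 * (‖x₀‖ + 1))) • x₀, ?_, ?_⟩
  · rw [norm_smul, Real.norm_of_nonneg ha.le, div_mul_eq_mul_div, div_lt_iff₀ (by positivity)]
    nlinarith [norm_nonneg x₀]
  · rw [map_smul, quadForm_smul]
    positivity

/-- No solution with positive initial value of the Chetaev form stays in the ball of radius `η`
up to a certain time `b`. -/
theorem exists_time_not_bounded [FiniteDimensional ℝ E] (hT : IsClosed T) (hT_top : ¬ BddAbove T)
    {F : ℝ → E → E} {r η κ t₀ : ℝ} (ht₀ : t₀ ∈ T) (hκ : 0 < κ)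
    (hF : ∀ t ∈ T, t₀ ≤ t → ∀ x : E, ‖x‖ < η → 0 ≤ quadForm s (L x) →
      κ * quadForm s (L x) ≤ quadDelta s (graininess T t) (L x) (L (F t x)))
    {x₀ : E} (hx₀ : 0 < quadForm s (L x₀)) :
    ∃ b ∈ T, t₀ ≤ b ∧ ∀ x : ℝ → E, x t₀ = x₀ → IsSolutionOn T r F (T ∩ Set.Icc t₀ b) x →
      ¬ ∀ t ∈ T ∩ Set.Icc t₀ b, ‖x t‖ < η := by
  obtain ⟨B, hB⟩ := (isCompact_closedBall (0 : E) η).exists_bound_of_continuousOn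
    ((continuous_quadForm s).comp L.continuous).continuousOn
  have hκx : 0 < κ / 2 * quadForm s (L x₀) := by positivity
  -- By such a time linear growth exceeds the bound `B` of the form on the closed ball.
  obtain ⟨b, hbT, hb⟩ := not_bddAbove_iff.1 hT_top
    (max t₀ (t₀ + B / (κ / 2 * quadForm s (L x₀))))
  have htb : t₀ ≤ b := (le_max_left _ _).trans hb.le
  refine ⟨b, hbT, htb, fun x hxt₀ hx hbound => ?_⟩
  have hgrow := quadForm_growth_of_solution hT hT_top ht₀ hbT htb hκ hF hx hbound
    (by rwa [hxt₀])
  have hle : quadForm s (L (x b)) ≤ B := (le_abs_self _).trans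
    (hB (x b) (mem_closedBall_zero_iff.2 (hbound b ⟨hbT, htb, le_rfl⟩).le))
  have hlt : B / (κ / 2 * quadForm s (L x₀)) < b - t₀ := by
    linarith [(le_max_right t₀ (t₀ + B / (κ / 2 * quadForm s (L x₀)))).trans_lt hb]
  rw [div_lt_iff₀ hκx] at hlt
  rw [hxt₀] at hgrow
  linarith

end Instability

end TimeScale

end

/-! ### Assembly of the instability theorem -/

open TimeScale in
theorem theorem7p12 (T : Set ℝ) (hT : IsClosed T) (hT_top : ¬ BddAbove T)
    (hsynd : TimeScale.IsSyndetic T)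
    {n : ℕ} (A : Matrix (Fin n) (Fin n) ℝ) (hA : TimeScale.IsStronglyUnstable T A) :
    ∃ ε > 0, ∀ r > 0, ∀ f : ℝ → EuclideanSpace ℝ (Fin n) → EuclideanSpace ℝ (Fin n),
      (∃ r₁ > 0, r₁ ≤ r ∧ ∀ t ∈ T, 0 ≤ t → ∀ x ∈ Metric.ball 0 r₁, ‖f t x‖ ≤ ε * ‖x‖) →
      ¬ TimeScale.ZeroIsStable T r (fun t x => Matrix.toEuclideanLin A x + f t x) ∧
      (ContinuousOn (Function.uncurry f) ((T ∩ Set.Ici 0) ×ˢ Metric.ball 0 r) →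
        TimeScale.SolutionsEscapeFromZero T r
          (fun t x => Matrix.toEuclideanLin A x + f t x)) := by
  obtain ⟨Λ₁, Λ₂, hroots, hΛ, h1, h2, h3⟩ := hA
  obtain ⟨c, hc, M, hM, t₀, ht₀, h0t₀, hgap⟩ :=
    exists_uniform_spectral_gap hT_top hsynd h1 h2 h3
  obtain ⟨L, s, x₀, hx₀, κ, hκ, ε, hε, hL⟩ := exists_chetaev_form A hroots hΛ
    (G := graininess T '' (T ∩ Set.Ici t₀)) ⟨_, t₀, ⟨ht₀, Set.self_mem_Ici⟩, rfl⟩ hc hM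
    (by rintro _ ⟨t, ⟨ht, htt⟩, rfl⟩; exact ⟨graininess_nonneg hT_top t, (hgap t ht htt).1⟩)
    (by rintro _ ⟨t, ⟨ht, htt⟩, rfl⟩; exact (hgap t ht htt).2.1)
    (by rintro _ ⟨t, ⟨ht, htt⟩, rfl⟩; exact (hgap t ht htt).2.2)
  refine ⟨ε, hε, fun r hr f ⟨r₁, hr₁, hr₁r, hf⟩ => ?_⟩
  have hF : ∀ η ≤ r₁, ∀ t ∈ T, t₀ ≤ t → ∀ x : EuclideanSpace ℝ (Fin n), ‖x‖ < η →
      0 ≤ quadForm s (L x) → κ * quadForm s (L x) ≤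
        quadDelta s (graininess T t) (L x) (L (Matrix.toEuclideanLin A x + f t x)) :=
    fun η hη t ht htt x hx => hL _ ⟨t, ⟨ht, htt⟩, rfl⟩ x (f t x)
      (hf t ht (h0t₀.trans htt) x (mem_ball_zero_iff.2 (hx.trans_le hη)))
  refine ⟨fun hstable => ?_, fun hcont => ?_⟩
  · obtain ⟨δ, hδ, hsol⟩ := hstable t₀ ht₀ h0t₀ r₁ hr₁
    obtain ⟨y, hyδ, hy⟩ := exists_small_quadForm_pos hx₀ hδ
    obtain ⟨b, -, -, hno⟩ := exists_time_not_bounded (r := r) hT hT_top ht₀ hκ (hF r₁ le_rfl) hy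
    obtain ⟨x, hx, hxt₀, hxr⟩ := hsol y hyδ
    have hsub : T ∩ Set.Icc t₀ b ⊆ T ∩ Set.Ici t₀ :=
      Set.inter_subset_inter_right T Set.Icc_subset_Ici_self
    exact hno x hxt₀ (hx.mono hsub) fun t ht => hxr t (hsub ht)
  -- Halving makes the radius strictly less than `r`, so the closed ball used for truncation lies
  -- where `f` is continuous.
  · refine ⟨t₀, ht₀, h0t₀, r₁ / 2, half_pos hr₁, fun δ hδ => ?_⟩
    obtain ⟨y, hyδ, hy⟩ := exists_small_quadForm_pos hx₀ hδ
    obtain ⟨b, hb, htb, hno⟩ := exists_time_not_bounded (r := r) hT hT_top ht₀ hκ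
      (hF (r₁ / 2) (half_le_self hr₁.le)) hy
    have hFcont : ContinuousOn (Function.uncurry fun t x => Matrix.toEuclideanLin A x + f t x)
        ((T ∩ Set.Icc t₀ b) ×ˢ Metric.ball 0 r) := by
      refine ContinuousOn.add ?_ (hcont.mono (Set.prod_mono_left
        (Set.inter_subset_inter_right T fun t ht => h0t₀.trans ht.1)))
      exact ((Matrix.toEuclideanLin A).continuous_of_finiteDimensional.comp
        continuous_snd).continuousOn
    obtain ⟨x, hxt₀, hcase⟩ := exists_solution_or_exit hT hT_top ht₀ hb htb (half_pos hr₁)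
      ((half_lt_self hr₁).trans_le hr₁r) hFcont y
    rcases hcase with ⟨hx, hbound⟩ | ⟨t₁, ht₁, htt₁, hx, hexit⟩
    · exact absurd hbound (hno x hxt₀ hx)
    · exact ⟨x, by rwa [hxt₀], t₁, ht₁, htt₁, hx, hexit⟩
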